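/- Let $(V,\sim)$ be a finite graph (the nearest-neighbour graph of a finite lattice) in which every site has at most $D$ neighbours. On the bosonic Fock space $\bigotimes_{x\in V}\ell^2(\mathbb N)$, with annihilation and creation operators $a_x,a_x^\dagger$ satisfying $[a_x,a_y^\dagger]=\delta_{xy}$ and with $n_x=a_x^\dagger a_x$, consider the Bose–Hubbard Hamiltonian $$H=-\sum_{x\sim y}J_{xy}\,(a_x^\dagger a_y+a_y^\dagger a_x)+\sum_{x\in V}\Big[\frac{U_x}{2}\,n_x(n_x-1)-\mu_x n_x\Big],$$ where the first sum runs over the unordered pairs of neighbours and the real parameters are uniformly bounded: $|J_{xy}|\le J$, $|\mu_x|\le\mu$, $0<U_{\min}\le U_x\le U_{\max}$. For an inverse temperature $\beta>0$ write $\langle X\rangle_{\beta H}=\operatorname{Tr}(Xe^{-\beta H})/\operatorname{Tr}e^{-\beta H}$. There are constants $C,c>0$, depending only on $U_{\min},U_{\max},\mu$, and for all $J$ and $D$ a threshold $\beta^*>0$, depending only on $U_{\min},U_{\max},\mu,J,D$, such that for every such model (in particular independently of the size of $V$), every $0<\beta<\beta^*$ and every site $x\in V$, the thermal average $\langle n_x\rangle_{\beta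 H}$ is well defined and $$\langle n_x\rangle_{\beta H}\le\frac{C}{\sqrt\beta}.$$ This temperature scaling is optimal, since it is attained in the on-site (Mott) case: if $J_{xy}=0$ for all $x\sim y$, then also $\langle n_x\rangle_{\beta H}\ge\dfrac{c}{\sqrt\beta}$. -/

import Mathlib

noncomputable section

namespace BoseHubbard

/-- The bosonic Hilbert space `⨂_{x ∈ V} ℓ²(ℕ)` of a finite set `V` of sites, realised as
`ℓ²(V → ℕ)`: an orthonormal basis is indexed by the occupation numbers `n : V → ℕ`. -/
abbrev FockSpace (V : Type*) : Type _ := lp (fun _ : V → ℕ => ℂ) 2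

/-- The finite linear combinations of occupation number states: a dense subspace of the Hilbert
space, invariant under the creation and annihilation operators, on which all (unbounded) operators
of the model are defined. -/
abbrev Core (V : Type*) : Type _ := (V → ℕ) →₀ ℂ

variable {V : Type*} [Fintype V] [DecidableEq V]

/-- The occupation number state `|n⟩`. -/
def ket (n : V → ℕ) : Core V := Finsupp.single n 1

/-- The inclusion of the core into the Hilbert space. -/
def toFock : Core V →ₗ[ℂ] FockSpace V :=
  Finsupp.linearCombination ℂ (fun n : V → ℕ => (lp.single 2 n (1 : ℂ) : FockSpace V))

/-- The annihilation operator `a_x |n⟩ = √(n_x) |n - δ_x⟩`. -/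
def annihilation (x : V) : Module.End ℂ (Core V) :=
  Finsupp.linearCombination ℂ
    (fun n : V → ℕ => ((Real.sqrt (n x) : ℝ) : ℂ) • ket (n - Pi.single x 1))

/-- The creation operator `a_x† |n⟩ = √(n_x + 1) |n + δ_x⟩`. -/
def creation (x : V) : Module.End ℂ (Core V) :=
  Finsupp.linearCombination ℂ
    (fun n : V → ℕ => ((Real.sqrt (n x + 1) : ℝ) : ℂ) • ket (n + Pi.single x 1))

/-- The local particle number operator `n_x = a_x† a_x`. -/
def number (x : V) : Module.End ℂ (Core V) := creation x * annihilation x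

/-- The hopping operator `a_x† a_y + a_y† a_x` of an unordered pair `{x, y}` of sites. -/
def hopping : Sym2 V → Module.End ℂ (Core V) :=
  Sym2.lift ⟨fun x y => creation x * annihilation y + creation y * annihilation x,
    fun _ _ => add_comm _ _⟩

/-- The data of an inhomogeneous Bose-Hubbard model on the sites `V`: the nearest neighbour graph,
the hopping amplitudes `J_{xy}` (only those of the edges matter), the on-site interactions `U_x`
and the chemical potentials `μ_x`. -/
structure Model (V : Type*) where
  graph : SimpleGraph V
  J : Sym2 V → ℝ
  U : V → ℝ
  μ : V → ℝ

/-- The parameters are uniformly bounded, `|J_{xy}| ≤ J`, `|μ_x| ≤ μ`, `Umin ≤ U_x ≤ Umax`, and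
every site has at most `D` nearest neighbours. -/
structure Model.BoundedBy (M : Model V) (J μ Umin Umax : ℝ) (D : ℕ) : Prop where
  abs_J_le : ∀ e ∈ M.graph.edgeSet, |M.J e| ≤ J
  abs_μ_le : ∀ x, |M.μ x| ≤ μ
  Umin_le : ∀ x, Umin ≤ M.U x
  le_Umax : ∀ x, M.U x ≤ Umax
  degree_le : ∀ x, (M.graph.neighborSet x).ncard ≤ D

open scoped Classical in
/-- The Bose-Hubbard Hamiltonian
`H = - ∑_{x ∼ y} J_{xy} (a_x† a_y + a_y† a_x) + ∑_x [(U_x / 2) n_x (n_x - 1) - μ_x n_x]`,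
the first sum being over the edges (unordered nearest neighbour pairs) of the graph. -/
def Model.hamiltonian (M : Model V) : Module.End ℂ (Core V) :=
  -(∑ e ∈ M.graph.edgeFinset, (M.J e : ℂ) • hopping e) +
    ∑ x : V, (((M.U x / 2 : ℝ) : ℂ) • (number x * (number x - 1)) - (M.μ x : ℂ) • number x)

/-- The bounded operator `T` on the Hilbert space is `e^{-βH}`:
`T |n⟩ = ∑_k (-β)^k / k! · H^k |n⟩` (convergence in norm) for all occupation number states `|n⟩`.
The Bose-Hubbard Hamiltonian preserves the finite-dimensional spaces of fixed total particle
number, so each `|n⟩` is an entire vector of it, and its closure is self-adjoint; the bounded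
operator that is described here is the one given by the functional calculus of this closure. -/
def IsBoltzmann (H : Module.End ℂ (Core V)) (β : ℝ) (T : FockSpace V →L[ℂ] FockSpace V) : Prop :=
  ∀ n : V → ℕ, HasSum
    (fun k : ℕ => (((-β) ^ k / (k.factorial : ℝ) : ℝ) : ℂ) • toFock ((H ^ k) (ket n)))
    (T (toFock (ket n)))

/-- There is at most one bounded operator `e^{-βH}`. -/
theorem IsBoltzmann.unique {H : Module.End ℂ (Core V)} {β : ℝ}
    {T T' : FockSpace V →L[ℂ] FockSpace V} (h : IsBoltzmann H β T) (h' : IsBoltzmann H β T') :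
    T = T' := by
  have hket : ∀ n : V → ℕ, T (lp.single 2 n 1) = T' (lp.single 2 n 1) := by
    intro n
    have e : toFock (ket n) = (lp.single 2 n (1 : ℂ) : FockSpace V) := by
      simp [toFock, ket, Finsupp.linearCombination_single]
    rw [← e]
    exact (h n).unique (h' n)
  refine ContinuousLinearMap.ext fun f => ?_
  have hf := lp.hasSum_single (p := 2) (by norm_num) f
  refine (T.hasSum hf).unique ?_
  convert T'.hasSum hf using 2 with n
  have e : (lp.single 2 n (f n) : FockSpace V) = f n • lp.single 2 n (1 : ℂ) := by
    rw [← lp.single_smul]; simp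
  simp only [e, map_smul, hket]

open scoped Classical in
/-- The operator `e^{-βH}` (with the value `0` if there is no such bounded operator). -/
def boltzmann (H : Module.End ℂ (Core V)) (β : ℝ) : FockSpace V →L[ℂ] FockSpace V :=
  if h : ∃ T, IsBoltzmann H β T then h.choose else 0

/-- The diagonal matrix element `⟨n| X e^{-βH} |n⟩ = ⟨X n, e^{-βH} n⟩` of a symmetric `X`. -/
def gibbsDiag (H : Module.End ℂ (Core V)) (β : ℝ) (X : Module.End ℂ (Core V)) (n : V → ℕ) : ℂ :=
  inner ℂ (toFock (X (ket n))) (boltzmann H β (toFock (ket n)))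

/-- `Tr (X e^{-βH})` for a symmetric operator `X`. -/
def gibbsTrace (H : Module.End ℂ (Core V)) (β : ℝ) (X : Module.End ℂ (Core V)) : ℂ :=
  ∑' n : V → ℕ, gibbsDiag H β X n

/-- The thermal average `⟨X⟩_{βH} = Tr (X e^{-βH}) / Tr e^{-βH}` of a symmetric operator `X`. -/
def thermalAverage (H : Module.End ℂ (Core V)) (β : ℝ) (X : Module.End ℂ (Core V)) : ℂ :=
  gibbsTrace H β X / gibbsTrace H β 1

/-- All the ingredients of the thermal average make sense: `e^{-βH}` exists as a bounded operator,
the series for `Tr e^{-βH}` and `Tr (X e^{-βH})` converge, and `Tr e^{-βH} ≠ 0`. -/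
structure HasThermalAverage (H : Module.End ℂ (Core V)) (β : ℝ) (X : Module.End ℂ (Core V)) :
    Prop where
  isBoltzmann : IsBoltzmann H β (boltzmann H β)
  summable_one : Summable (gibbsDiag H β 1)
  summable : Summable (gibbsDiag H β X)
  trace_ne_zero : gibbsTrace H β 1 ≠ 0

end BoseHubbard

end

noncomputable section

namespace BoseHubbard

open Filter
open scoped ComplexConjugate

set_option linter.unusedSectionVars false

variable {V : Type*} [Fintype V] [DecidableEq V]

/-! ### The inner product on the core -/

/-! Write s = √β and Z(H) = Tr e^{-βH}. A single site with energy U n²/2 holds about 1/s particles;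
the point is to keep this order in the presence of hopping, uniformly in the size of V. Since H
conserves the total particle number, all trace estimates are made in finite-dimensional sectors and
then summed.

Two tools compare models. Klein's inequality (`EigenResolution.sum_weight_sub_le`) makes Z monotone
under form inequalities and, after a shift by a mean value, gives the Peierls-Bogoliubov inequality
(`exp_average_mul_partition_le`). The form bound |a_x†a_y + a_y†a_x| ≤ n_x + n_y
(`abs_re_ip_hopping_le`) lets hopping be deleted in exchange for a larger chemical potential.

Fix x, let H₀ be H without the hopping at x, let j_z be the total |J| of the edges joining z to x
(for z = x, of all edges at x), and put H' = H₀ - t n_x - ∑_z j_z n_z. Then e^{βt⟨n_x⟩_H} Z(H) ≤ Z(H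
- t n_x) ≤ Z(H') ≤ e^{βA} Z(H₀) ≤ e^{βA} Z(H), where A = t⟨n_x⟩_{H'} + ∑_z j_z ⟨n_z⟩_{H'}. The last
step holds because the hopping at x changes n_x and so has mean zero in the Gibbs state of H₀. Hence
t⟨n_x⟩_H ≤ A (`mul_occupation_le`).

In H' the site x is isolated, so its occupation is controlled by an explicit one-site recursion
(`occupation_le_of_isolated`). The other sites live in a model with one fewer hopping site, in which
μ_z plus the hopping strength at z is unchanged. Induction on the set of non-isolated sites with t =
1/s (`occupation_le`) closes with a fixed constant, because the neighbours enter only with the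
relative weight s·∑_z j_z, which is small. The lower bound for an isolated site comes from shifting
its occupation by about a/s (`le_occupation_of_isolated`), with the upper bound as input. -/

theorem toFock_single (n : V → ℕ) (c : ℂ) :
    toFock (Finsupp.single n c) = c • (lp.single 2 n (1 : ℂ) : FockSpace V) := by
  simp [toFock, Finsupp.linearCombination_single]

theorem toFock_ket (n : V → ℕ) : toFock (ket n) = (lp.single 2 n (1 : ℂ) : FockSpace V) := by
  simp [ket, toFock_single]

/-- The inner product of the Hilbert space, on the core. -/
def ip (f g : Core V) : ℂ := inner ℂ (toFock f) (toFock g)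

theorem ip_add_left (f f' g : Core V) : ip (f + f') g = ip f g + ip f' g := by
  simp [ip]

theorem ip_add_right (f g g' : Core V) : ip f (g + g') = ip f g + ip f g' := by
  simp [ip]

theorem ip_sub_right (f g g' : Core V) : ip f (g - g') = ip f g - ip f g' := by
  simp [ip]

theorem ip_smul_left (c : ℂ) (f g : Core V) : ip (c • f) g = conj c * ip f g := by
  simp only [ip, map_smul, inner_smul_left]

theorem ip_smul_right (c : ℂ) (f g : Core V) : ip f (c • g) = c * ip f g := by
  simp [ip]

theorem ip_neg_right (f g : Core V) : ip f (-g) = -ip f g := by simp [ip]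

theorem ip_neg_left (f g : Core V) : ip (-f) g = -ip f g := by simp [ip]

theorem ip_zero_left (g : Core V) : ip 0 g = 0 := by simp [ip]

theorem ip_zero_right (g : Core V) : ip g 0 = 0 := by simp [ip]

theorem ip_sum_right {ι : Type*} (s : Finset ι) (f : Core V) (g : ι → Core V) :
    ip f (∑ i ∈ s, g i) = ∑ i ∈ s, ip f (g i) := by
  simp [ip]

theorem ip_sum_left {ι : Type*} (s : Finset ι) (f : ι → Core V) (g : Core V) :
    ip (∑ i ∈ s, f i) g = ∑ i ∈ s, ip (f i) g := by
  simp [ip]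

theorem conj_ip (f g : Core V) : conj (ip f g) = ip g f := by simp [ip]

theorem ip_ket_left (n : V → ℕ) (f : Core V) : ip (ket n) f = f n := by
  induction f using Finsupp.induction_linear with
  | zero => simp [ip]
  | add f g hf hg => simp [ip_add_right, hf, hg]
  | single m c =>
    rw [ip, toFock_ket, toFock_single, inner_smul_right, lp.inner_single_left, lp.single_apply]
    by_cases h : n = m
    · subst h; simp
    · simp [h]

theorem ip_ket_right (n : V → ℕ) (f : Core V) : ip f (ket n) = conj (f n) := by
  rw [← conj_ip, ip_ket_left]

theorem ket_apply (n m : V → ℕ) : ket n m = if n = m then 1 else 0 := by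
  simp [ket, Finsupp.single_apply]

theorem single_eq_smul_ket (n : V → ℕ) (c : ℂ) : (Finsupp.single n c : Core V) = c • ket n := by
  simp [ket]

/-- Linear maps on the core are determined by their values on occupation number states. -/
theorem core_induction {P : Core V → Prop} (f : Core V) (h0 : P 0)
    (hadd : ∀ f g, P f → P g → P (f + g)) (hket : ∀ (c : ℂ) n, P (c • ket n)) : P f := by
  induction f using Finsupp.induction_linear with
  | zero => exact h0
  | add f g hf hg => exact hadd f g hf hg
  | single m c => rw [single_eq_smul_ket]; exact hket c m

theorem end_ext {A B : Module.End ℂ (Core V)} (h : ∀ n, A (ket n) = B (ket n)) : A = B := by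
  refine LinearMap.ext fun f => ?_
  induction f using core_induction with
  | h0 => simp
  | hadd f g hf hg => simp [hf, hg]
  | hket c n => simp [h]

theorem end_apply (A : Module.End ℂ (Core V)) (f : Core V) (m : V → ℕ) :
    A f m = f.sum fun l c => c * A (ket l) m := by
  induction f using Finsupp.induction_linear with
  | zero => simp
  | add f g hf hg =>
    rw [Finsupp.sum_add_index' (by simp) (by intros; ring), map_add, Finsupp.add_apply, hf, hg]
  | single l c => rw [Finsupp.sum_single_index (by simp), single_eq_smul_ket]; simp

/-- `A` and `B` are adjoint to each other on the core. -/
def Adjoint (A B : Module.End ℂ (Core V)) : Prop := ∀ f g, ip (A f) g = ip f (B g)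

theorem adjoint_of_ket {A B : Module.End ℂ (Core V)}
    (h : ∀ n m, ip (A (ket n)) (ket m) = ip (ket n) (B (ket m))) : Adjoint A B := by
  intro f g
  induction f using core_induction with
  | h0 => simp [ip_zero_left]
  | hadd f f' hf hf' => simp [ip_add_left, hf, hf']
  | hket c n =>
    induction g using core_induction with
    | h0 => simp [ip_zero_right]
    | hadd f f' hf hf' => simp only [map_add, ip_add_right, hf, hf']
    | hket d m => simp [ip_smul_left, ip_smul_right, h]

theorem Adjoint.symm {A B : Module.End ℂ (Core V)} (h : Adjoint A B) : Adjoint B A := by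
  intro f g
  rw [← conj_ip, ← h, conj_ip]

theorem Adjoint.add {A B A' B' : Module.End ℂ (Core V)} (h : Adjoint A B) (h' : Adjoint A' B') :
    Adjoint (A + A') (B + B') := by
  intro f g
  simp [ip_add_left, ip_add_right, h f g, h' f g]

theorem Adjoint.neg {A B : Module.End ℂ (Core V)} (h : Adjoint A B) : Adjoint (-A) (-B) := by
  intro f g
  rw [LinearMap.neg_apply, LinearMap.neg_apply, ip_neg_left, ip_neg_right, h f g]

theorem Adjoint.mul {A B A' B' : Module.End ℂ (Core V)} (h : Adjoint A B) (h' : Adjoint A' B') :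
    Adjoint (A * A') (B' * B) := by
  intro f g
  simp only [Module.End.mul_apply, h (A' f) g, h' f (B g)]

theorem Adjoint.real_smul {A B : Module.End ℂ (Core V)} (h : Adjoint A B) (c : ℝ) :
    Adjoint ((c : ℂ) • A) ((c : ℂ) • B) := by
  intro f g
  simp only [LinearMap.smul_apply, ip_smul_left, ip_smul_right, h f g, Complex.conj_ofReal]

theorem adjoint_one : Adjoint (1 : Module.End ℂ (Core V)) 1 := fun _ _ => rfl

theorem Adjoint.sum {ι : Type*} (s : Finset ι) {A B : ι → Module.End ℂ (Core V)}
    (h : ∀ i ∈ s, Adjoint (A i) (B i)) : Adjoint (∑ i ∈ s, A i) (∑ i ∈ s, B i) := by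
  intro f g
  simp only [LinearMap.sum_apply, ip_sum_left, ip_sum_right]
  exact Finset.sum_congr rfl fun i hi => h i hi f g

/-! ### Conserved quantities -/

/-- The operator `A` conserves the quantity `q` of the occupation numbers. -/
def Conserves {γ : Type*} (q : (V → ℕ) → γ) (A : Module.End ℂ (Core V)) : Prop :=
  ∀ m n, q m ≠ q n → A (ket n) m = 0

section Conserves

variable {γ : Type*} {q : (V → ℕ) → γ} {A B : Module.End ℂ (Core V)}

theorem Conserves.add (hA : Conserves q A) (hB : Conserves q B) : Conserves q (A + B) := by
  intro m n h
  simp [hA m n h, hB m n h]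

theorem Conserves.smul (c : ℂ) (hA : Conserves q A) : Conserves q (c • A) := by
  intro m n h
  simp [hA m n h]

theorem Conserves.neg (hA : Conserves q A) : Conserves q (-A) := by
  intro m n h
  simp [hA m n h]

theorem conserves_zero : Conserves q (0 : Module.End ℂ (Core V)) := by
  intro m n _
  simp

theorem conserves_one : Conserves q (1 : Module.End ℂ (Core V)) := by
  intro m n h
  have : n ≠ m := by rintro rfl; exact h rfl
  simp [ket_apply, this]

theorem Conserves.sum {ι : Type*} (s : Finset ι) {A : ι → Module.End ℂ (Core V)}
    (h : ∀ i ∈ s, Conserves q (A i)) : Conserves q (∑ i ∈ s, A i) := by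
  intro m n hmn
  rw [LinearMap.sum_apply, Finsupp.finsetSum_apply]
  exact Finset.sum_eq_zero fun i hi => h i hi m n hmn

theorem Conserves.apply_eq_zero (hA : Conserves q A) {f : Core V} {c : γ}
    (hf : ∀ n, q n ≠ c → f n = 0) {m : V → ℕ} (hm : q m ≠ c) : A f m = 0 := by
  rw [end_apply]
  refine Finset.sum_eq_zero fun l _ => ?_
  by_cases hl : q l = c
  · simp [hA m l (by rw [hl]; exact hm)]
  · simp [hf l hl]

theorem Conserves.mul (hA : Conserves q A) (hB : Conserves q B) : Conserves q (A * B) :=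
  fun _ n h => hA.apply_eq_zero (c := q n) (fun l hl => hB l n hl) h

theorem Conserves.pow (hA : Conserves q A) (k : ℕ) : Conserves q (A ^ k) := by
  induction k with
  | zero => exact conserves_one
  | succ k ih => rw [pow_succ]; exact ih.mul hA

end Conserves

/-! ### Creation, annihilation, number and hopping operators -/

theorem annihilation_ket (x : V) (n : V → ℕ) :
    annihilation x (ket n) = ((Real.sqrt (n x) : ℝ) : ℂ) • ket (n - Pi.single x 1) := by
  simp [annihilation, ket, Finsupp.linearCombination_single]

theorem creation_ket (x : V) (n : V → ℕ) :
    creation x (ket n) = ((Real.sqrt (n x + 1) : ℝ) : ℂ) • ket (n + Pi.single x 1) := by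
  simp [creation, ket, Finsupp.linearCombination_single]

theorem sub_single_add_single {n : V → ℕ} {x : V} (h : n x ≠ 0) :
    n - Pi.single x 1 + Pi.single x 1 = n := by
  ext z
  by_cases hz : z = x
  · subst hz; simp; omega
  · simp [hz]

theorem adjoint_annihilation_creation (x : V) : Adjoint (annihilation x) (creation x) := by
  refine adjoint_of_ket fun n m => ?_
  rw [annihilation_ket, creation_ket, ip_smul_left, ip_smul_right, ip_ket_left, ip_ket_left,
    ket_apply, ket_apply]
  by_cases h : n = m + Pi.single x 1
  · subst h; simp
  · rw [if_neg (Ne.symm h)]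
    by_cases h0 : n x = 0
    · simp [h0]
    · rw [if_neg]
      · simp
      · rintro rfl
        exact h (sub_single_add_single h0).symm

/-- Subtraction of occupation numbers is truncated, so the target configuration is meaningful only
for n y ≠ 0; the last clause disposes of the other case. -/
theorem creation_annihilation_ket (x y : V) (n : V → ℕ) :
    ∃ c : ℂ, (creation x * annihilation y) (ket n) =
      c • ket (n - Pi.single y 1 + Pi.single x 1) ∧ (n y = 0 → c = 0) := by
  refine ⟨(Real.sqrt (n y) : ℝ) * (Real.sqrt ((n - Pi.single y 1 : V → ℕ) x + 1) : ℝ), ?_, ?_⟩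
  · rw [Module.End.mul_apply, annihilation_ket, map_smul, creation_ket, smul_smul]
  · intro h; simp [h]

theorem number_ket (x : V) (n : V → ℕ) : number x (ket n) = (n x : ℂ) • ket n := by
  rw [number, Module.End.mul_apply, annihilation_ket, map_smul, creation_ket, smul_smul]
  by_cases h : n x = 0
  · simp [h]
  · rw [sub_single_add_single h, ← Complex.ofReal_mul]
    congr 1
    have : ((n - Pi.single x 1 : V → ℕ) x : ℝ) + 1 = n x := by
      have : (n - Pi.single x 1 : V → ℕ) x + 1 = n x := by simp; omega
      exact_mod_cast this
    rw [this, Real.mul_self_sqrt (Nat.cast_nonneg _)]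
    simp

/-- The total number of particles. -/
def total (n : V → ℕ) : ℕ := ∑ x, n x

theorem total_add (n m : V → ℕ) : total (n + m) = total n + total m := by
  simp [total, Finset.sum_add_distrib]

theorem total_single (x : V) (k : ℕ) : total (Pi.single x k : V → ℕ) = k := by
  simp [total]

theorem conserves_total_creation_annihilation (x y : V) :
    Conserves total (creation x * annihilation y) := by
  intro m n h
  obtain ⟨c, hc, h0⟩ := creation_annihilation_ket x y n
  rw [hc]
  by_cases hy : n y = 0
  · simp [h0 hy]
  · have : total (n - Pi.single y 1 + Pi.single x 1) = total n := by
      conv_rhs => rw [← sub_single_add_single hy]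
      simp [total_add, total_single]
    have : n - Pi.single y 1 + Pi.single x 1 ≠ m := by
      rintro rfl; exact h this
    simp [ket_apply, this]

theorem conserves_creation_annihilation {x y z : V} (hx : z ≠ x) (hy : z ≠ y) :
    Conserves (fun n : V → ℕ => n z) (creation x * annihilation y) := by
  intro m n h
  obtain ⟨c, hc, h0⟩ := creation_annihilation_ket x y n
  rw [hc]
  have : n - Pi.single y 1 + Pi.single x 1 ≠ m := by
    rintro rfl; exact h (by simp [hx, hy])
  simp [ket_apply, this]

theorem conserves_of_diag {γ : Type*} (q : (V → ℕ) → γ) {A : Module.End ℂ (Core V)}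
    {d : (V → ℕ) → ℂ} (h : ∀ n, A (ket n) = d n • ket n) : Conserves q A := by
  intro m n hmn
  have : n ≠ m := by rintro rfl; exact hmn rfl
  simp [h, ket_apply, this]

theorem adjoint_of_diag {A : Module.End ℂ (Core V)} {d : (V → ℕ) → ℝ}
    (h : ∀ n, A (ket n) = (d n : ℂ) • ket n) : Adjoint A A := by
  refine adjoint_of_ket fun n m => ?_
  rw [h, h, ip_smul_left, ip_smul_right, ip_ket_left, ket_apply]
  by_cases hmn : m = n
  · subst hmn; simp
  · simp [hmn]

theorem hopping_mk (x y : V) :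
    hopping s(x, y) = creation x * annihilation y + creation y * annihilation x := rfl

theorem conserves_total_hopping (e : Sym2 V) : Conserves total (hopping e) := by
  induction e with | _ x y => ?_
  exact (conserves_total_creation_annihilation x y).add (conserves_total_creation_annihilation y x)

theorem conserves_hopping {e : Sym2 V} {z : V} (hz : z ∉ e) :
    Conserves (fun n : V → ℕ => n z) (hopping e) := by
  induction e with | _ x y => ?_
  simp only [Sym2.mem_iff, not_or] at hz
  exact (conserves_creation_annihilation hz.1 hz.2).add (conserves_creation_annihilation hz.2 hz.1)

/-- A hopping operator changes the occupation number of the end points of the edge. -/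
theorem hopping_ket_eq_zero {e : Sym2 V} (he : ¬ e.IsDiag) {x : V} (hx : x ∈ e) {m n : V → ℕ}
    (h : m x = n x) : hopping e (ket n) m = 0 := by
  obtain ⟨y, rfl⟩ := Sym2.mem_iff_exists.1 hx
  have hxy : x ≠ y := by simpa using he
  have key : ∀ u v : V, u ≠ v → (x = u ∨ x = v) →
      (creation u * annihilation v) (ket n) m = 0 := by
    intro u v huv hxuv
    obtain ⟨c, hc, h0⟩ := creation_annihilation_ket u v n
    rw [hc]
    by_cases hv : n v = 0
    · simp [h0 hv]
    · have : n - Pi.single v 1 + Pi.single u 1 ≠ m := by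
        rintro rfl
        rcases hxuv with rfl | rfl
        · simp [huv] at h
        · simp [huv.symm] at h; omega
      simp [ket_apply, this]
  rw [hopping_mk, LinearMap.add_apply, Finsupp.add_apply, key x y hxy (Or.inl rfl),
    key y x hxy.symm (Or.inr rfl), add_zero]

theorem adjoint_hopping (e : Sym2 V) : Adjoint (hopping e) (hopping e) := by
  induction e with | _ x y => ?_
  have h := fun z : V => adjoint_annihilation_creation z
  have := ((h x).symm.mul (h y)).add ((h y).symm.mul (h x))
  rw [hopping_mk]
  nth_rewrite 2 [add_comm]
  exact this

/-- The hopping operator is bounded by the number of particles on its edge, as a form. -/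
theorem abs_re_ip_hopping_le {e : Sym2 V} (he : ¬ e.IsDiag) (f : Core V) :
    |(ip f (hopping e f)).re| ≤ ∑ z with z ∈ e, (ip f (number z f)).re := by
  induction e with | _ x y => ?_
  have hxy : x ≠ y := by simpa using he
  have hfil : (Finset.univ.filter fun z => z ∈ s(x, y)) = {x, y} := by ext z; simp
  rw [hfil, Finset.sum_pair hxy]
  have h1 : ∀ u v : V, ip f ((creation u * annihilation v) f) =
      ip (annihilation u f) (annihilation v f) := by
    intro u v
    rw [Module.End.mul_apply, ← adjoint_annihilation_creation u]
  rw [hopping_mk, LinearMap.add_apply, ip_add_right, number, number, h1, h1, h1, h1]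
  have hn : ∀ u, (ip (annihilation u f) (annihilation u f)).re =
      ‖toFock (annihilation u f)‖ ^ 2 := by
    intro u
    rw [ip, inner_self_eq_norm_sq_to_K]
    norm_cast
  rw [hn, hn]
  -- Cauchy-Schwarz; then 2pq ≤ p² + q² with p = ‖a_x f‖ and q = ‖a_y f‖.
  have hc : ∀ u v, |(ip (annihilation u f) (annihilation v f)).re| ≤
      ‖toFock (annihilation u f)‖ * ‖toFock (annihilation v f)‖ := by
    intro u v
    exact (Complex.abs_re_le_norm _).trans (norm_inner_le_norm _ _)
  have h2 := hc x y
  have h3 := hc y x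
  rw [Complex.add_re]
  rw [abs_le] at *
  constructor <;> nlinarith [sq_nonneg (‖toFock (annihilation x f)‖ - ‖toFock (annihilation y f)‖)]

/-- Allowing any `s` beyond the support makes it possible to sum over a whole sector. -/
theorem ip_diag {A : Module.End ℂ (Core V)} {d : (V → ℕ) → ℝ}
    (h : ∀ n, A (ket n) = (d n : ℂ) • ket n) (f : Core V) {s : Finset (V → ℕ)}
    (hs : f.support ⊆ s) :
    ip f (A f) = ((∑ n ∈ s, d n * ‖f n‖ ^ 2 : ℝ) : ℂ) := by
  have h1 : ∀ n, A f n = d n * f n := by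
    intro n
    rw [← ip_ket_left, ← adjoint_of_diag h, h, ip_smul_left, ip_ket_left]
    simp
  have hf : f = ∑ n ∈ s, f n • ket n := by
    conv_lhs => rw [← Finsupp.sum_single f]
    rw [Finsupp.sum_of_support_subset _ hs _ (by simp)]
    simp [single_eq_smul_ket]
  conv_lhs => rw [hf, ip_sum_left]
  push_cast
  refine Finset.sum_congr rfl fun n _ => ?_
  rw [← hf, ip_smul_left, ip_ket_left, h1, ← Complex.conj_mul']
  ring

/-! ### Spectral decomposition in the sectors of fixed total particle number -/

/-- The occupation numbers with `N` particles in total. -/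
def sector (N : ℕ) : Finset (V → ℕ) := Finset.piAntidiag Finset.univ N

@[simp] theorem mem_sector {N : ℕ} {n : V → ℕ} : n ∈ sector N ↔ total n = N := by
  simp [sector, total]

/-- An orthonormal basis of eigenvectors of `H`, of which the one with index `i` lies in the
sector of `i`. -/
structure EigenResolution (H : Module.End ℂ (Core V)) where
  ev : (V → ℕ) → ℝ
  vec : (V → ℕ) → Core V
  eig : ∀ i, H (vec i) = (ev i : ℂ) • vec i
  supp : ∀ i n, total n ≠ total i → vec i n = 0
  orth : ∀ i j, total i = total j → ip (vec i) (vec j) = if i = j then 1 else 0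
  complete : ∀ m n, total m = total n →
    ∑ i ∈ sector (total n), vec i m * conj (vec i n) = if m = n then 1 else 0

theorem eq_sum_ket {f : Core V} {s : Finset (V → ℕ)} (h : ∀ n, n ∉ s → f n = 0) :
    f = ∑ n ∈ s, f n • ket n := by
  ext m
  simp only [Finsupp.finsetSum_apply, Finsupp.smul_apply, ket_apply, smul_eq_mul, mul_ite, mul_one,
    mul_zero, Finset.sum_ite_eq']
  by_cases hm : m ∈ s
  · simp [hm]
  · simp [hm, h m hm]

/-- On a sector, H is a finite Hermitian matrix. Its eigenbasis is indexed by the configurations of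
that sector, so the bases of all sectors glue to a single family over `V → ℕ`; outside the sector
the values are a junk 0. -/
theorem exists_eigenResolution_sector {H : Module.End ℂ (Core V)} (hsym : Adjoint H H)
    (hcons : Conserves total H) (N : ℕ) : ∃ (ev : (V → ℕ) → ℝ) (vec : (V → ℕ) → Core V),
      (∀ i, total i = N → H (vec i) = (ev i : ℂ) • vec i) ∧
      (∀ i, total i = N → ∀ n, total n ≠ N → vec i n = 0) ∧
      (∀ i j, total i = N → total j = N → ip (vec i) (vec j) = if i = j then 1 else 0) ∧
      (∀ m n, total m = N → total n = N →
        ∑ i ∈ sector N, vec i m * conj (vec i n) = if m = n then 1 else 0) := by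
  let A : Matrix (sector (V := V) N) (sector (V := V) N) ℂ := Matrix.of fun m n => H (ket n.1) m.1
  have hA : A.IsHermitian := by
    ext m n
    simp only [A, Matrix.conjTranspose_apply, Matrix.of_apply]
    rw [← ip_ket_left, ← ip_ket_left, ← hsym, ← conj_ip]
    exact Complex.conj_conj _
  let u := hA.eigenvectorBasis
  let w : sector (V := V) N → Core V := fun j => ∑ n : sector (V := V) N, (u j).ofLp n • ket n.1
  have hw : ∀ j n, w j n.1 = (u j).ofLp n := by
    intro j n
    simp only [w, Finsupp.finsetSum_apply, Finsupp.smul_apply, ket_apply, smul_eq_mul, mul_ite,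
      mul_one, mul_zero, Subtype.coe_inj, Finset.sum_ite_eq']
    simp
  have hw0 : ∀ j n, n ∉ sector N → w j n = 0 := by
    intro j n hn
    simp only [w, Finsupp.finsetSum_apply, Finsupp.smul_apply, ket_apply, smul_eq_mul, mul_ite,
      mul_one, mul_zero]
    refine Finset.sum_eq_zero fun x _ => ?_
    rw [if_neg]
    rintro rfl
    exact hn x.2
  let ev : (V → ℕ) → ℝ := fun i => if h : i ∈ sector N then hA.eigenvalues ⟨i, h⟩ else 0
  let vec : (V → ℕ) → Core V := fun i => if h : i ∈ sector N then w ⟨i, h⟩ else 0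
  have hev : ∀ i (h : i ∈ sector N), ev i = hA.eigenvalues ⟨i, h⟩ :=
    fun i h => by simp only [ev, dif_pos h]
  have hvec : ∀ i (h : i ∈ sector N), vec i = w ⟨i, h⟩ :=
    fun i h => by simp only [vec, dif_pos h]
  refine ⟨ev, vec, ?_, ?_, ?_, ?_⟩
  · intro i hi
    rw [hev i (mem_sector.2 hi), hvec i (mem_sector.2 hi)]
    set j : sector (V := V) N := ⟨i, mem_sector.2 hi⟩
    ext m
    by_cases hm : m ∈ sector N
    · have h1 := congrFun (hA.mulVec_eigenvectorBasis j) ⟨m, hm⟩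
      have h2 : H (w j) m = A.mulVec (u j).ofLp ⟨m, hm⟩ := by
        simp only [w, map_sum, map_smul, Finsupp.finsetSum_apply, Finsupp.smul_apply,
          Matrix.mulVec, dotProduct, A, Matrix.of_apply, smul_eq_mul]
        exact Finset.sum_congr rfl fun n _ => mul_comm _ _
      rw [h2, h1, Finsupp.smul_apply, hw j ⟨m, hm⟩]
      simp [u]
    · rw [Finsupp.smul_apply, hw0 j m hm, smul_zero]
      refine hcons.apply_eq_zero (c := N) (fun n hn => hw0 j n ?_) ?_
      · simpa using hn
      · simpa using hm
  · intro i hi n hn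
    rw [hvec i (mem_sector.2 hi)]
    exact hw0 _ n (by simpa using hn)
  · intro i j hi hj
    rw [hvec i (mem_sector.2 hi), hvec j (mem_sector.2 hj)]
    have h1 : ip (w ⟨i, mem_sector.2 hi⟩) (w ⟨j, mem_sector.2 hj⟩) =
        inner ℂ (u ⟨i, mem_sector.2 hi⟩) (u ⟨j, mem_sector.2 hj⟩) := by
      conv_lhs => simp only [w]
      rw [ip_sum_left, PiLp.inner_apply]
      refine Finset.sum_congr rfl fun n _ => ?_
      rw [ip_smul_left, ip_ket_left]
      have := hw ⟨j, mem_sector.2 hj⟩ n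
      simp only [w] at this
      rw [this]
      simp [mul_comm]
    rw [h1, orthonormal_iff_ite.1 u.orthonormal]
    simp
  · intro m n hm hn
    have h1 := u.sum_inner_mul_inner (EuclideanSpace.single ⟨m, mem_sector.2 hm⟩ 1)
      (EuclideanSpace.single ⟨n, mem_sector.2 hn⟩ 1)
    rw [← Finset.sum_coe_sort]
    have h2 : ∀ i : sector (V := V) N, vec i.1 m * conj (vec i.1 n) =
        inner ℂ (EuclideanSpace.single ⟨m, mem_sector.2 hm⟩ (1 : ℂ)) (u i) *
          inner ℂ (u i) (EuclideanSpace.single ⟨n, mem_sector.2 hn⟩ 1) := by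
      intro i
      rw [hvec i.1 i.2, EuclideanSpace.inner_single_left, EuclideanSpace.inner_single_right,
        hw i ⟨m, mem_sector.2 hm⟩, hw i ⟨n, mem_sector.2 hn⟩]
      simp
    refine (Finset.sum_congr rfl fun i _ => h2 i).trans (h1.trans ?_)
    rw [EuclideanSpace.inner_single_left, PiLp.single_apply]
    simp

theorem exists_eigenResolution {H : Module.End ℂ (Core V)} (hsym : Adjoint H H)
    (hcons : Conserves total H) : Nonempty (EigenResolution H) := by
  choose ev vec h1 h2 h3 h4 using exists_eigenResolution_sector hsym hcons
  refine ⟨⟨fun i => ev (total i) i, fun i => vec (total i) i, fun i => h1 _ i rfl,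
    fun i => h2 _ i rfl, ?_, ?_⟩⟩
  · intro i j hij
    simp only [← hij]
    exact h3 _ i j rfl hij.symm
  · intro m n hmn
    rw [← h4 (total n) m n hmn rfl]
    refine Finset.sum_congr rfl fun i hi => ?_
    rw [mem_sector.1 hi]

/-- The matrix elements `⟨m| e^{-βH} |n⟩`, as a power series. -/
def expMatrix (H : Module.End ℂ (Core V)) (β : ℝ) (m n : V → ℕ) : ℂ :=
  ∑' k : ℕ, (((-β) ^ k / (k.factorial : ℝ) : ℝ) : ℂ) * (H ^ k) (ket n) m

/-- The Boltzmann weight `⟨n| e^{-βH} |n⟩`. -/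
def weight (H : Module.End ℂ (Core V)) (β : ℝ) (n : V → ℕ) : ℝ := (expMatrix H β n n).re

/-- The trace of `X e^{-βH}` over a sector. -/
def sectorTrace (H : Module.End ℂ (Core V)) (β : ℝ) (X : Module.End ℂ (Core V)) (N : ℕ) : ℂ :=
  ∑ m ∈ sector N, ∑ n ∈ sector N, X (ket n) m * expMatrix H β n m

theorem ip_self_eq_sum {f : Core V} {s : Finset (V → ℕ)} (h : ∀ n, n ∉ s → f n = 0) :
    ip f f = ((∑ n ∈ s, ‖f n‖ ^ 2 : ℝ) : ℂ) := by
  have hs : f.support ⊆ s := by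
    intro n hn
    by_contra hns
    exact Finsupp.mem_support_iff.1 hn (h n hns)
  have := ip_diag (A := (1 : Module.End ℂ (Core V))) (d := fun _ => 1) (by simp) f hs
  simpa using this

theorem conserves_expMatrix {γ : Type*} {q : (V → ℕ) → γ} {H : Module.End ℂ (Core V)}
    (h : Conserves q H) (β : ℝ) {m n : V → ℕ} (hmn : q m ≠ q n) : expMatrix H β m n = 0 := by
  simp [expMatrix, h.pow _ m n hmn]

namespace EigenResolution

variable {H : Module.End ℂ (Core V)} (R : EigenResolution H)

theorem ket_eq (R : EigenResolution H) (n : V → ℕ) :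
    ket n = ∑ i ∈ sector (total n), conj (R.vec i n) • R.vec i := by
  ext m
  simp only [Finsupp.finsetSum_apply, Finsupp.smul_apply, smul_eq_mul]
  by_cases hm : total m = total n
  · have h := R.complete m n hm
    simp only [mul_comm (conj _)]
    rw [h, ket_apply]
    simp [eq_comm]
  · rw [ket_apply, if_neg (by rintro rfl; exact hm rfl), Finset.sum_eq_zero]
    intro i hi
    rw [R.supp i m (by rw [mem_sector.1 hi]; exact hm), mul_zero]

theorem eq_sum {f : Core V} {N : ℕ} (hf : ∀ n, total n ≠ N → f n = 0) :
    f = ∑ i ∈ sector N, ip (R.vec i) f • R.vec i := by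
  have h := eq_sum_ket (f := f) (s := sector N) (fun n hn => hf n (by simpa using hn))
  have h1 : ∀ i, ip (R.vec i) f = ∑ n ∈ sector N, f n * conj (R.vec i n) := by
    intro i
    conv_lhs => rw [h, ip_sum_right]
    simp [ip_smul_right, ip_ket_right]
  simp only [h1, Finset.sum_smul]
  rw [Finset.sum_comm]
  conv_lhs => rw [h]
  refine Finset.sum_congr rfl fun n hn => ?_
  conv_lhs => rw [R.ket_eq n, mem_sector.1 hn, Finset.smul_sum]
  simp [smul_smul]

/-- Parseval's identity for the eigenbasis of a sector. -/
theorem sum_norm_ip_sq {f : Core V} {N : ℕ} (hf : ∀ n, total n ≠ N → f n = 0) :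
    ∑ i ∈ sector N, ‖ip (R.vec i) f‖ ^ 2 = (ip f f).re := by
  conv_rhs => arg 1; arg 2; rw [R.eq_sum hf]
  rw [ip_sum_right, Complex.re_sum]
  refine Finset.sum_congr rfl fun i _ => ?_
  rw [ip_smul_right, ← conj_ip (R.vec i) f, Complex.mul_conj']
  norm_cast

theorem add_pow_vec (c : ℝ) (k : ℕ) (i : V → ℕ) :
    ((H + (c : ℂ) • (1 : Module.End ℂ (Core V))) ^ k) (R.vec i) =
      (((R.ev i + c) ^ k : ℝ) : ℂ) • R.vec i := by
  induction k with
  | zero => simp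
  | succ k ih =>
    rw [pow_succ', Module.End.mul_apply, ih, map_smul, LinearMap.add_apply, R.eig,
      LinearMap.smul_apply, Module.End.one_apply, ← add_smul, smul_smul]
    congr 1
    push_cast
    ring

/-- The constant shift is carried along because it is needed twice: to normalise a perturbation to
mean zero, and to describe the energy of an added particle. -/
theorem hasSum_add (β c : ℝ) (m n : V → ℕ) :
    HasSum (fun k : ℕ => (((-β) ^ k / (k.factorial : ℝ) : ℝ) : ℂ) *
        ((H + (c : ℂ) • (1 : Module.End ℂ (Core V))) ^ k) (ket n) m)
      (∑ i ∈ sector (total n),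
        (Real.exp (-β * (R.ev i + c)) : ℂ) * (R.vec i m * conj (R.vec i n))) := by
  have h1 : ∀ k : ℕ, (((-β) ^ k / (k.factorial : ℝ) : ℝ) : ℂ) *
        ((H + (c : ℂ) • (1 : Module.End ℂ (Core V))) ^ k) (ket n) m =
      ∑ i ∈ sector (total n), (((-β * (R.ev i + c)) ^ k / (k.factorial : ℝ) : ℝ) : ℂ) *
        (R.vec i m * conj (R.vec i n)) := by
    intro k
    conv_lhs => rw [R.ket_eq n]
    rw [map_sum, Finsupp.finsetSum_apply, Finset.mul_sum]
    refine Finset.sum_congr rfl fun i _ => ?_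
    rw [map_smul, R.add_pow_vec, Finsupp.smul_apply, Finsupp.smul_apply, mul_pow]
    simp only [smul_eq_mul]
    push_cast
    ring
  simp only [h1]
  refine hasSum_sum fun i _ => HasSum.mul_right _ ?_
  rw [Complex.hasSum_ofReal, Real.exp_eq_exp_ℝ]
  exact NormedSpace.expSeries_div_hasSum_exp (-β * (R.ev i + c))

theorem hasSum (β : ℝ) (m n : V → ℕ) :
    HasSum (fun k : ℕ => (((-β) ^ k / (k.factorial : ℝ) : ℝ) : ℂ) * (H ^ k) (ket n) m)
      (∑ i ∈ sector (total n), (Real.exp (-β * R.ev i) : ℂ) * (R.vec i m * conj (R.vec i n))) := by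
  simpa using R.hasSum_add β 0 m n

theorem expMatrix_eq (β : ℝ) (m n : V → ℕ) : expMatrix H β m n =
    ∑ i ∈ sector (total n), (Real.exp (-β * R.ev i) : ℂ) * (R.vec i m * conj (R.vec i n)) :=
  (R.hasSum β m n).tsum_eq

theorem expMatrix_add (R : EigenResolution H) (β c : ℝ) (m n : V → ℕ) :
    expMatrix (H + (c : ℂ) • (1 : Module.End ℂ (Core V))) β m n =
      Real.exp (-β * c) * expMatrix H β m n := by
  rw [expMatrix, (R.hasSum_add β c m n).tsum_eq, R.expMatrix_eq, Finset.mul_sum]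
  refine Finset.sum_congr rfl fun i _ => ?_
  rw [mul_add, Real.exp_add]
  push_cast
  ring

theorem expMatrix_self (β : ℝ) (n : V → ℕ) : expMatrix H β n n =
    ((∑ i ∈ sector (total n), Real.exp (-β * R.ev i) * ‖R.vec i n‖ ^ 2 : ℝ) : ℂ) := by
  rw [R.expMatrix_eq]
  push_cast
  refine Finset.sum_congr rfl fun i _ => ?_
  rw [Complex.mul_conj']

theorem weight_eq (β : ℝ) (n : V → ℕ) : weight H β n =
    ∑ i ∈ sector (total n), Real.exp (-β * R.ev i) * ‖R.vec i n‖ ^ 2 := by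
  rw [weight, R.expMatrix_self, Complex.ofReal_re]

theorem expMatrix_self_eq_weight (R : EigenResolution H) (β : ℝ) (n : V → ℕ) :
    expMatrix H β n n = (weight H β n : ℂ) := by
  rw [R.weight_eq, R.expMatrix_self]

theorem weight_nonneg (R : EigenResolution H) (β : ℝ) (n : V → ℕ) : 0 ≤ weight H β n := by
  rw [R.weight_eq]
  positivity

theorem ip_vec_self (i : V → ℕ) : ip (R.vec i) (R.vec i) = 1 := by
  rw [R.orth i i rfl, if_pos rfl]

theorem sum_norm_vec_sq (i : V → ℕ) : ∑ n ∈ sector (total i), ‖R.vec i n‖ ^ 2 = 1 := by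
  have h := ip_self_eq_sum (f := R.vec i) (s := sector (total i))
    (fun n hn => R.supp i n (by simpa using hn))
  rw [R.ip_vec_self] at h
  exact_mod_cast h.symm

theorem sum_weight (β : ℝ) (N : ℕ) :
    ∑ n ∈ sector N, weight H β n = ∑ i ∈ sector N, Real.exp (-β * R.ev i) := by
  have h : ∀ n ∈ sector N, weight H β n =
      ∑ i ∈ sector N, Real.exp (-β * R.ev i) * ‖R.vec i n‖ ^ 2 := by
    intro n hn
    rw [R.weight_eq, mem_sector.1 hn]
  rw [Finset.sum_congr rfl h, Finset.sum_comm]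
  refine Finset.sum_congr rfl fun i hi => ?_
  rw [← Finset.mul_sum, ← mem_sector.1 hi, R.sum_norm_vec_sq, mul_one]

theorem sectorTrace_eq (β : ℝ) (X : Module.End ℂ (Core V)) (N : ℕ) : sectorTrace H β X N =
    ∑ i ∈ sector N, (Real.exp (-β * R.ev i) : ℂ) * ip (R.vec i) (X (R.vec i)) := by
  have h1 : ∀ i ∈ sector N, ip (R.vec i) (X (R.vec i)) =
      ∑ m ∈ sector N, ∑ n ∈ sector N, X (ket n) m * (R.vec i n * conj (R.vec i m)) := by
    intro i hi
    have h := eq_sum_ket (f := R.vec i) (s := sector N)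
      (fun n hn => R.supp i n (by rw [mem_sector.1 hi]; simpa using hn))
    conv_lhs => rw [h, map_sum, ip_sum_left]
    refine Finset.sum_congr rfl fun m _ => ?_
    rw [ip_smul_left, ip_ket_left, Finsupp.finsetSum_apply, Finset.mul_sum]
    refine Finset.sum_congr rfl fun n _ => ?_
    rw [map_smul, Finsupp.smul_apply, smul_eq_mul]
    ring
  have h2 : ∀ i ∈ sector N, (Real.exp (-β * R.ev i) : ℂ) * ip (R.vec i) (X (R.vec i)) =
      (Real.exp (-β * R.ev i) : ℂ) *
        ∑ m ∈ sector N, ∑ n ∈ sector N, X (ket n) m * (R.vec i n * conj (R.vec i m)) :=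
    fun i hi => by rw [h1 i hi]
  rw [Finset.sum_congr rfl h2]
  simp only [Finset.mul_sum]
  rw [Finset.sum_comm, sectorTrace]
  refine Finset.sum_congr rfl fun m hm => ?_
  rw [Finset.sum_comm]
  refine Finset.sum_congr rfl fun n _ => ?_
  rw [R.expMatrix_eq, mem_sector.1 hm, Finset.mul_sum]
  refine Finset.sum_congr rfl fun i _ => ?_
  ring

/-- **Klein's inequality** for the trace of the exponential, in a sector. -/
theorem sum_weight_sub_le {A B : Module.End ℂ (Core V)} (P : EigenResolution A)
    (Q : EigenResolution B) (β : ℝ) (N : ℕ) :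
    ∑ n ∈ sector N, weight B β n - β * (sectorTrace B β (A - B) N).re ≤
      ∑ n ∈ sector N, weight A β n := by
  have hs : ∀ j ∈ sector N, ∀ n, total n ≠ N → Q.vec j n = 0 := fun j hj n hn =>
    Q.supp j n (by rwa [mem_sector.1 hj])
  have hs' : ∀ i ∈ sector N, ∀ n, total n ≠ N → P.vec i n = 0 := fun i hi n hn =>
    P.supp i n (by rwa [mem_sector.1 hi])
  -- The squared overlaps of the two eigenbases form a doubly stochastic matrix. Averaging over it
  -- reduces the claim to the scalar tangent-line inequality e^b (1 + a - b) ≤ e^a, with a and b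
  -- eigenvalues of -βA and -βB.
  have hsum1 : ∀ j ∈ sector N, ∑ i ∈ sector N, ‖ip (P.vec i) (Q.vec j)‖ ^ 2 = 1 := by
    intro j hj
    rw [P.sum_norm_ip_sq (hs j hj), Q.ip_vec_self, Complex.one_re]
  have hsum2 : ∀ i ∈ sector N, ∑ j ∈ sector N, ‖ip (P.vec i) (Q.vec j)‖ ^ 2 = 1 := by
    intro i hi
    have := Q.sum_norm_ip_sq (hs' i hi)
    rw [P.ip_vec_self, Complex.one_re] at this
    rw [← this]
    refine Finset.sum_congr rfl fun j _ => ?_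
    rw [← conj_ip, Complex.norm_conj]
  have hA : ∀ j ∈ sector N, (ip (Q.vec j) (A (Q.vec j))).re =
      ∑ i ∈ sector N, P.ev i * ‖ip (P.vec i) (Q.vec j)‖ ^ 2 := by
    intro j hj
    conv_lhs => arg 1; arg 2; rw [P.eq_sum (hs j hj), map_sum]
    rw [ip_sum_right, Complex.re_sum]
    refine Finset.sum_congr rfl fun i _ => ?_
    rw [map_smul, P.eig, ip_smul_right, ip_smul_right, ← conj_ip (P.vec i) (Q.vec j)]
    rw [show ip (P.vec i) (Q.vec j) * ((P.ev i : ℂ) * conj (ip (P.vec i) (Q.vec j))) =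
      (P.ev i : ℂ) * (ip (P.vec i) (Q.vec j) * conj (ip (P.vec i) (Q.vec j))) by ring,
      Complex.mul_conj']
    norm_cast
  have hB : ∀ j, (ip (Q.vec j) (B (Q.vec j))).re = Q.ev j := by
    intro j
    rw [Q.eig, ip_smul_right, Q.ip_vec_self]
    simp
  rw [P.sum_weight, Q.sum_weight, Q.sectorTrace_eq, Complex.re_sum, Finset.mul_sum,
    ← Finset.sum_sub_distrib]
  have hl : ∀ j ∈ sector N, Real.exp (-β * Q.ev j) -
      β * ((Real.exp (-β * Q.ev j) : ℂ) * ip (Q.vec j) ((A - B) (Q.vec j))).re =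
      ∑ i ∈ sector N, ‖ip (P.vec i) (Q.vec j)‖ ^ 2 *
        (Real.exp (-β * Q.ev j) * (1 + (-β * P.ev i - -β * Q.ev j))) := by
    intro j hj
    rw [Complex.re_ofReal_mul, LinearMap.sub_apply, ip_sub_right, Complex.sub_re, hA j hj, hB j]
    have e : ∀ i ∈ sector N, ‖ip (P.vec i) (Q.vec j)‖ ^ 2 *
        (Real.exp (-β * Q.ev j) * (1 + (-β * P.ev i - -β * Q.ev j))) =
        Real.exp (-β * Q.ev j) * (1 + β * Q.ev j) * ‖ip (P.vec i) (Q.vec j)‖ ^ 2 -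
        β * Real.exp (-β * Q.ev j) * (P.ev i * ‖ip (P.vec i) (Q.vec j)‖ ^ 2) := by
      intro i _
      ring
    rw [Finset.sum_congr rfl e, Finset.sum_sub_distrib, ← Finset.mul_sum, ← Finset.mul_sum,
      hsum1 j hj]
    ring
  have hr : ∑ i ∈ sector N, Real.exp (-β * P.ev i) =
      ∑ j ∈ sector N, ∑ i ∈ sector N, ‖ip (P.vec i) (Q.vec j)‖ ^ 2 * Real.exp (-β * P.ev i) := by
    rw [Finset.sum_comm]
    refine Finset.sum_congr rfl fun i hi => ?_
    rw [← Finset.sum_mul, hsum2 i hi, one_mul]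
  rw [Finset.sum_congr rfl hl, hr]
  refine Finset.sum_le_sum fun j _ => Finset.sum_le_sum fun i _ => ?_
  refine mul_le_mul_of_nonneg_left ?_ (by positivity)
  have h := Real.add_one_le_exp (-β * P.ev i - -β * Q.ev j)
  calc Real.exp (-β * Q.ev j) * (1 + (-β * P.ev i - -β * Q.ev j))
      ≤ Real.exp (-β * Q.ev j) * Real.exp (-β * P.ev i - -β * Q.ev j) :=
        mul_le_mul_of_nonneg_left (by linarith) (Real.exp_nonneg _)
    _ = Real.exp (-β * P.ev i) := by rw [← Real.exp_add]; ring_nf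

/-! ### The Boltzmann operator -/

/-- In the orthonormal eigenbasis the sector block of e^{-βH} is diagonal with entries at most C, so
its operator norm is at most C. -/
theorem sum_norm_sq_le {β C : ℝ} (hC : ∀ i, Real.exp (-β * R.ev i) ≤ C) (N : ℕ)
    (f : (V → ℕ) → ℂ) :
    ∑ m ∈ sector N, ‖∑ n ∈ sector N, expMatrix H β m n * f n‖ ^ 2 ≤
      C ^ 2 * ∑ n ∈ sector N, ‖f n‖ ^ 2 := by
  let F : Core V := ∑ n ∈ sector N, f n • ket n
  let G : Core V := ∑ i ∈ sector N, ((Real.exp (-β * R.ev i) : ℂ) * ip (R.vec i) F) • R.vec i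
  have hF1 : ∀ n, total n = N → F n = f n := by
    intro n hn
    simp [F, Finsupp.finsetSum_apply, ket_apply, hn]
  have hF0 : ∀ n, total n ≠ N → F n = 0 := by
    intro n hn
    simp [F, Finsupp.finsetSum_apply, ket_apply, hn]
  have hG0 : ∀ n, total n ≠ N → G n = 0 := by
    intro n hn
    simp only [G, Finsupp.finsetSum_apply, Finsupp.smul_apply]
    refine Finset.sum_eq_zero fun i hi => ?_
    rw [R.supp i n (by rwa [mem_sector.1 hi]), smul_zero]
  have hG1 : ∀ m, total m = N → G m = ∑ n ∈ sector N, expMatrix H β m n * f n := by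
    intro m _
    have e : ∀ i, ip (R.vec i) F = ∑ n ∈ sector N, f n * conj (R.vec i n) := by
      intro i
      simp only [F]
      rw [ip_sum_right]
      simp [ip_smul_right, ip_ket_right]
    simp only [G, Finsupp.finsetSum_apply, Finsupp.smul_apply, e, smul_eq_mul, Finset.mul_sum,
      Finset.sum_mul]
    rw [Finset.sum_comm]
    refine Finset.sum_congr rfl fun n hn => ?_
    rw [R.expMatrix_eq, mem_sector.1 hn, Finset.sum_mul]
    refine Finset.sum_congr rfl fun i _ => ?_
    ring
  have hipG : ∀ i ∈ sector N, ip (R.vec i) G = (Real.exp (-β * R.ev i) : ℂ) * ip (R.vec i) F := by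
    intro i hi
    simp only [G]
    rw [ip_sum_right, Finset.sum_eq_single i]
    · rw [ip_smul_right, R.ip_vec_self, mul_one]
    · intro j hj hji
      rw [ip_smul_right, R.orth i j (by rw [mem_sector.1 hi, mem_sector.1 hj]), if_neg hji.symm,
        mul_zero]
    · exact fun h => absurd hi h
  have hnG := R.sum_norm_ip_sq hG0
  have hnF := R.sum_norm_ip_sq hF0
  rw [ip_self_eq_sum (s := sector N) (fun n hn => hG0 n (by simpa using hn)),
    Complex.ofReal_re] at hnG
  rw [ip_self_eq_sum (s := sector N) (fun n hn => hF0 n (by simpa using hn)),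
    Complex.ofReal_re] at hnF
  have hsG : ∑ n ∈ sector N, ‖G n‖ ^ 2 =
      ∑ m ∈ sector N, ‖∑ n ∈ sector N, expMatrix H β m n * f n‖ ^ 2 :=
    Finset.sum_congr rfl fun n hn => by rw [hG1 n (mem_sector.1 hn)]
  have hsF : ∑ n ∈ sector N, ‖F n‖ ^ 2 = ∑ n ∈ sector N, ‖f n‖ ^ 2 :=
    Finset.sum_congr rfl fun n hn => by rw [hF1 n (mem_sector.1 hn)]
  rw [← hsG, ← hsF, ← hnG, ← hnF, Finset.mul_sum]
  refine Finset.sum_le_sum fun i hi => ?_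
  rw [hipG i hi, norm_mul, mul_pow, Complex.norm_real, Real.norm_of_nonneg (Real.exp_nonneg _)]
  gcongr
  exact hC i

/-- The sectors are mutually orthogonal, so blocks with a common norm bound assemble to one bounded
operator; on a ket the exponential series only involves one finite block. -/
theorem exists_isBoltzmann {β C : ℝ} (hC0 : 0 ≤ C) (hC : ∀ i, Real.exp (-β * R.ev i) ≤ C) :
    ∃ T : FockSpace V →L[ℂ] FockSpace V, IsBoltzmann H β T := by
  let a : ((V → ℕ) → ℂ) → (V → ℕ) → ℂ := fun f m =>
    ∑ n ∈ sector (total m), expMatrix H β m n * f n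
  have hbound : ∀ (f : FockSpace V) (s : Finset (V → ℕ)),
      ∑ m ∈ s, ‖a f m‖ ^ (2 : ENNReal).toReal ≤ (C * ‖f‖) ^ (2 : ENNReal).toReal := by
    intro f s
    have e2 : (2 : ENNReal).toReal = ((2 : ℕ) : ℝ) := by simp
    simp only [e2, Real.rpow_natCast]
    let t : Finset ℕ := s.image total
    have hdisj : (t : Set ℕ).PairwiseDisjoint (fun N => (sector N : Finset (V → ℕ))) := by
      intro M _ N _ hMN
      refine Finset.disjoint_left.2 fun n hn hn' => hMN ?_
      rw [← mem_sector.1 hn, mem_sector.1 hn']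
    calc ∑ m ∈ s, ‖a f m‖ ^ 2
        ≤ ∑ m ∈ t.biUnion sector, ‖a f m‖ ^ 2 := by
          refine Finset.sum_le_sum_of_subset_of_nonneg (fun m hm => ?_) (fun _ _ _ => by positivity)
          simp only [Finset.mem_biUnion, mem_sector, t, Finset.mem_image]
          exact ⟨total m, ⟨m, hm, rfl⟩, rfl⟩
      _ = ∑ N ∈ t, ∑ m ∈ sector N, ‖a f m‖ ^ 2 := Finset.sum_biUnion hdisj
      _ ≤ ∑ N ∈ t, C ^ 2 * ∑ n ∈ sector N, ‖f n‖ ^ 2 := by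
          refine Finset.sum_le_sum fun N _ => ?_
          refine le_trans (le_of_eq ?_) (R.sum_norm_sq_le hC N f)
          refine Finset.sum_congr rfl fun m hm => ?_
          simp only [a, mem_sector.1 hm]
      _ = C ^ 2 * ∑ n ∈ t.biUnion sector, ‖f n‖ ^ 2 := by
          rw [Finset.sum_biUnion hdisj, Finset.mul_sum]
      _ ≤ (C * ‖f‖) ^ 2 := by
          rw [mul_pow]
          refine mul_le_mul_of_nonneg_left ?_ (by positivity)
          have := lp.sum_rpow_le_norm_rpow (p := 2) (by simp) f (t.biUnion sector)
          simpa only [e2, Real.rpow_natCast] using this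
  let L : FockSpace V →ₗ[ℂ] FockSpace V :=
    { toFun := fun f => ⟨a f, memℓp_gen' (hbound f)⟩
      map_add' := by
        intro f g
        refine lp.ext (funext fun m => ?_)
        change a (f + g) m = a f m + a g m
        simp [a, mul_add, Finset.sum_add_distrib]
      map_smul' := by
        intro c f
        refine lp.ext (funext fun m => ?_)
        simp only [a, lp.coeFn_smul, Pi.smul_apply, smul_eq_mul, RingHom.id_apply, Finset.mul_sum]
        refine Finset.sum_congr rfl fun n _ => ?_
        ring }
  have hL : ∀ f, ‖L f‖ ≤ C * ‖f‖ := fun f =>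
    lp.norm_le_of_forall_sum_le (by simp) (by positivity) (hbound f)
  refine ⟨L.mkContinuous C hL, fun n => ?_⟩
  have hT : L.mkContinuous C hL (toFock (ket n)) = ∑ m ∈ sector (total n),
      expMatrix H β m n • (lp.single 2 m (1 : ℂ) : FockSpace V) := by
    refine lp.ext (funext fun l => ?_)
    rw [LinearMap.mkContinuous_apply, lp.coeFn_sum, Finset.sum_apply]
    have h1 : (L (toFock (ket n)) : (V → ℕ) → ℂ) l = a (toFock (ket n)) l := rfl
    rw [h1]
    simp only [a, lp.coeFn_smul, Pi.smul_apply, toFock_ket, lp.single_apply, smul_eq_mul,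
      Pi.single_apply, mul_ite, mul_one, mul_zero, Finset.sum_ite_eq', Finset.sum_ite_eq,
      mem_sector]
    simp [eq_comm]
  have hcore : ∀ f : Core V, (∀ m, total m ≠ total n → f m = 0) →
      toFock f = ∑ m ∈ sector (total n), f m • (lp.single 2 m (1 : ℂ) : FockSpace V) := by
    intro f hf
    conv_lhs => rw [eq_sum_ket (f := f) (s := sector (total n))
      (fun m hm => hf m (by simpa using hm))]
    simp [toFock_ket]
  have hzero : ∀ k m, total m ≠ total n → (H ^ k) (ket n) m = 0 := by
    intro k m hm
    conv_lhs => rw [R.ket_eq n]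
    have h0 := fun i => R.add_pow_vec 0 k i
    simp only [Complex.ofReal_zero, zero_smul, add_zero] at h0
    simp only [map_sum, map_smul, h0, Finsupp.finsetSum_apply, Finsupp.smul_apply]
    refine Finset.sum_eq_zero fun i hi => ?_
    rw [R.supp i m (by rwa [mem_sector.1 hi])]
    simp
  rw [hT]
  have hk : ∀ k : ℕ, (((-β) ^ k / (k.factorial : ℝ) : ℝ) : ℂ) • toFock ((H ^ k) (ket n)) =
      ∑ m ∈ sector (total n), ((((-β) ^ k / (k.factorial : ℝ) : ℝ) : ℂ) * (H ^ k) (ket n) m) •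
        (lp.single 2 m (1 : ℂ) : FockSpace V) := by
    intro k
    rw [hcore _ (hzero k), Finset.smul_sum]
    simp only [smul_smul]
  simp only [hk]
  refine hasSum_sum fun m _ => HasSum.smul_const ?_ _
  rw [R.expMatrix_eq]
  exact R.hasSum β m n

end EigenResolution

/-! ### Matrix elements of the Boltzmann operator as power series -/

theorem isBoltzmann_boltzmann {H : Module.End ℂ (Core V)} {β : ℝ}
    (h : ∃ T : FockSpace V →L[ℂ] FockSpace V, IsBoltzmann H β T) :
    IsBoltzmann H β (boltzmann H β) := by
  rw [boltzmann, dif_pos h]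
  exact h.choose_spec

theorem IsBoltzmann.inner_eq {H : Module.End ℂ (Core V)} {β : ℝ}
    {T : FockSpace V →L[ℂ] FockSpace V} (h : IsBoltzmann H β T) (m n : V → ℕ) :
    inner ℂ (toFock (ket m)) (T (toFock (ket n))) = expMatrix H β m n := by
  have h1 := (innerSL ℂ (toFock (ket m))).hasSum (h n)
  rw [expMatrix]
  refine Eq.trans ?_ (h1.tsum_eq.symm.trans ?_)
  · rfl
  · refine tsum_congr fun k => ?_
    simp only [map_smul, innerSL_apply_apply, smul_eq_mul]
    congr 1
    exact ip_ket_left m _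

theorem gibbsDiag_of_diag {H : Module.End ℂ (Core V)} {β : ℝ} (R : EigenResolution H)
    (h : IsBoltzmann H β (boltzmann H β)) {X : Module.End ℂ (Core V)} {d : (V → ℕ) → ℝ}
    (hX : ∀ n, X (ket n) = (d n : ℂ) • ket n) (n : V → ℕ) :
    gibbsDiag H β X n = ((d n * weight H β n : ℝ) : ℂ) := by
  rw [gibbsDiag, hX, map_smul, inner_smul_left, h.inner_eq, R.expMatrix_self_eq_weight]
  simp

section Hamiltonian

/-! ### Sums over all occupation numbers by sectors -/

theorem pairwiseDisjoint_sector (s : Set ℕ) :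
    s.PairwiseDisjoint (fun N => (sector N : Finset (V → ℕ))) := by
  intro M _ N _ hMN
  refine Finset.disjoint_left.2 fun n hn hn' => hMN ?_
  rw [← mem_sector.1 hn, mem_sector.1 hn']

/-- The occupation numbers with less than `K` particles. -/
def ball (K : ℕ) : Finset (V → ℕ) := (Finset.range K).biUnion sector

theorem mem_ball {K : ℕ} {n : V → ℕ} : n ∈ ball K ↔ total n < K := by
  simp [ball]

theorem sum_ball (f : (V → ℕ) → ℝ) (K : ℕ) :
    ∑ n ∈ ball K, f n = ∑ N ∈ Finset.range K, ∑ n ∈ sector N, f n :=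
  Finset.sum_biUnion (pairwiseDisjoint_sector _)

theorem tendsto_ball : Tendsto (ball : ℕ → Finset (V → ℕ)) atTop atTop := by
  refine tendsto_atTop_finset_of_monotone (fun K L hKL n hn => ?_) fun n => ⟨total n + 1, ?_⟩
  · exact mem_ball.2 ((mem_ball.1 hn).trans_le hKL)
  · exact mem_ball.2 (Nat.lt_succ_self _)

/-- Klein's inequality compares traces over sectors, not individual weights, so comparisons pass to
the full sum along the exhausting balls. -/
theorem tsum_le_tsum_of_sector {f g : (V → ℕ) → ℝ} (hf : Summable f) (hg : Summable g)
    (h : ∀ N, ∑ n ∈ sector N, f n ≤ ∑ n ∈ sector N, g n) : ∑' n, f n ≤ ∑' n, g n := by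
  refine le_of_tendsto_of_tendsto' (hf.hasSum.comp tendsto_ball) (hg.hasSum.comp tendsto_ball) ?_
  intro K
  simp only [Function.comp_apply, sum_ball]
  exact Finset.sum_le_sum fun N _ => h N

theorem summable_of_sector {f g : (V → ℕ) → ℝ} (hf : ∀ n, 0 ≤ f n) (hg0 : ∀ n, 0 ≤ g n)
    (hg : Summable g) (h : ∀ N, ∑ n ∈ sector N, f n ≤ ∑ n ∈ sector N, g n) : Summable f := by
  refine summable_of_sum_le hf (c := ∑' n, g n) fun s => ?_
  obtain ⟨K, hK⟩ := (tendsto_atTop.1 (tendsto_ball (V := V)) s).exists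
  calc ∑ n ∈ s, f n ≤ ∑ n ∈ ball K, f n :=
        Finset.sum_le_sum_of_subset_of_nonneg hK fun n _ _ => hf n
    _ ≤ ∑ n ∈ ball K, g n := by
        rw [sum_ball, sum_ball]
        exact Finset.sum_le_sum fun N _ => h N
    _ ≤ ∑' n, g n := hg.sum_le_tsum _ fun n _ => hg0 n

/-- A finite set of configurations lies in a box, over which the sum factorises into geometric sums,
one per site. -/
theorem summable_exp_neg_total : Summable fun n : V → ℕ => Real.exp (-(total n : ℝ)) := by
  have hg : Summable fun k : ℕ => Real.exp (-(k : ℝ)) := by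
    simpa using Real.summable_exp_nat_mul_of_ge (c := -1) (by norm_num)
      (f := fun k => (k : ℝ)) (fun _ => le_rfl)
  refine summable_of_sum_le (c := ∏ _x : V, ∑' k : ℕ, Real.exp (-(k : ℝ)))
    (fun n => Real.exp_nonneg _) fun s => ?_
  obtain ⟨K, hK⟩ := (tendsto_atTop.1 (tendsto_ball (V := V)) s).exists
  have hsub : s ⊆ Fintype.piFinset fun _ : V => Finset.range K := by
    intro n hn
    rw [Fintype.mem_piFinset]
    intro x
    have h1 := mem_ball.1 (hK hn)
    have h2 : n x ≤ total n :=
      Finset.single_le_sum (f := n) (fun _ _ => Nat.zero_le _) (Finset.mem_univ x)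
    exact Finset.mem_range.2 (h2.trans_lt h1)
  calc ∑ n ∈ s, Real.exp (-(total n : ℝ))
      ≤ ∑ n ∈ Fintype.piFinset fun _ : V => Finset.range K, Real.exp (-(total n : ℝ)) :=
        Finset.sum_le_sum_of_subset_of_nonneg hsub fun n _ _ => Real.exp_nonneg _
    _ = ∏ _x : V, ∑ k ∈ Finset.range K, Real.exp (-(k : ℝ)) := by
        rw [Finset.prod_univ_sum]
        refine Finset.sum_congr rfl fun n _ => ?_
        rw [← Real.exp_sum, total]
        push_cast
        rw [Finset.sum_neg_distrib]
    _ ≤ ∏ _x : V, ∑' k : ℕ, Real.exp (-(k : ℝ)) :=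
        Finset.prod_le_prod (fun _ _ => Finset.sum_nonneg fun _ _ => Real.exp_nonneg _)
          fun _ _ => hg.sum_le_tsum _ fun _ _ => Real.exp_nonneg _

theorem sectorTrace_diag {H X : Module.End ℂ (Core V)} (R : EigenResolution H) (β : ℝ)
    {d : (V → ℕ) → ℝ} (hX : ∀ n, X (ket n) = (d n : ℂ) • ket n) (N : ℕ) :
    (sectorTrace H β X N).re = ∑ n ∈ sector N, d n * weight H β n := by
  rw [sectorTrace, Complex.re_sum]
  refine Finset.sum_congr rfl fun m hm => ?_
  rw [Finset.sum_eq_single m]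
  · rw [hX, R.expMatrix_self_eq_weight, Finsupp.smul_apply, ket_apply, if_pos rfl]
    simp
  · intro n _ hn
    rw [hX, Finsupp.smul_apply, ket_apply, if_neg hn]
    simp
  · exact fun h => absurd hm h

/-- If the weight vanished, every eigenvector of the sector would vanish at `n`, contradicting
completeness. -/
theorem EigenResolution.weight_pos {H : Module.End ℂ (Core V)} (R : EigenResolution H) (β : ℝ)
    (n : V → ℕ) : 0 < weight H β n := by
  rw [R.weight_eq]
  by_contra! h
  have h0 : ∀ i ∈ sector (total n), R.vec i n = 0 := by
    intro i hi
    have := (Finset.sum_eq_zero_iff_of_nonneg (fun i _ => by positivity)).1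
      (le_antisymm h (Finset.sum_nonneg fun i _ => by positivity)) i hi
    simpa [(Real.exp_pos _).ne'] using this
  have := R.complete n n rfl
  rw [Finset.sum_eq_zero fun i hi => by rw [h0 i hi, zero_mul], if_pos rfl] at this
  exact zero_ne_one this

/-! ### The partition function -/

/-- The partition function `Tr e^{-βH}`. -/
def partition (H : Module.End ℂ (Core V)) (β : ℝ) : ℝ := ∑' n, weight H β n

/-- The thermal average of a function of the occupation numbers. -/
def average (H : Module.End ℂ (Core V)) (β : ℝ) (g : (V → ℕ) → ℝ) : ℝ :=
  (∑' n, g n * weight H β n) / partition H β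

theorem partition_pos {H : Module.End ℂ (Core V)} (R : EigenResolution H) {β : ℝ}
    (hs : Summable (weight H β)) : 0 < partition H β :=
  hs.tsum_pos (R.weight_nonneg β) 0 (R.weight_pos β 0)

/-- The **Peierls-Bogoliubov inequality** for a diagonal perturbation. -/
theorem exp_average_mul_partition_le {H G : Module.End ℂ (Core V)} {g : (V → ℕ) → ℝ}
    (R : EigenResolution H) (R' : EigenResolution (H - G))
    (hG : ∀ n, G (ket n) = (g n : ℂ) • ket n) {β : ℝ} (hs : Summable (weight H β))
    (hs' : Summable (weight (H - G) β)) (hg : Summable fun n => g n * weight H β n)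
    (hsym : Adjoint (H - G) (H - G)) (hcons : Conserves total (H - G)) :
    Real.exp (β * average H β g) * partition H β ≤ partition (H - G) β := by
  set c := average H β g with hc
  have hZ := partition_pos R hs
  -- With this shift A - H has mean zero in the Gibbs state of H, so the linear term of Klein's
  -- inequality drops out after summation, leaving Z(H) ≤ Z(A) = e^{-βc} Z(H - G).
  let A := H - G + (c : ℂ) • (1 : Module.End ℂ (Core V))
  obtain ⟨P⟩ : Nonempty (EigenResolution A) :=
    exists_eigenResolution (hsym.add (adjoint_one.real_smul c)) (hcons.add (conserves_one.smul _))
  have hA : ∀ n, weight A β n = Real.exp (-β * c) * weight (H - G) β n := by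
    intro n
    simp only [weight, A]
    rw [R'.expMatrix_add, Complex.re_ofReal_mul]
  have hX : ∀ n, (A - H) (ket n) = ((c - g n : ℝ) : ℂ) • ket n := by
    intro n
    simp only [A]
    rw [LinearMap.sub_apply, LinearMap.add_apply, LinearMap.sub_apply, hG, LinearMap.smul_apply,
      Module.End.one_apply, Complex.ofReal_sub, sub_smul]
    abel
  have h1 : ∀ N, ∑ n ∈ sector N, ((1 - β * c) * weight H β n + β * (g n * weight H β n)) ≤
      ∑ n ∈ sector N, Real.exp (-β * c) * weight (H - G) β n := by
    intro N
    have h := EigenResolution.sum_weight_sub_le P R β N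
    rw [sectorTrace_diag R β hX, Finset.mul_sum, ← Finset.sum_sub_distrib] at h
    simp only [hA] at h
    refine le_trans (le_of_eq (Finset.sum_congr rfl fun n _ => ?_)) h
    ring
  have h2 := tsum_le_tsum_of_sector ((hs.mul_left _).add (hg.mul_left _)) (hs'.mul_left _) h1
  rw [(hs.mul_left _).tsum_add (hg.mul_left _), tsum_mul_left, tsum_mul_left, tsum_mul_left] at h2
  have h3 : ∑' n, g n * weight H β n = c * partition H β := by
    rw [hc, average, div_mul_cancel₀ _ hZ.ne']
  rw [h3] at h2
  have h4 : partition H β ≤ Real.exp (-β * c) * partition (H - G) β := by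
    unfold partition at *
    nlinarith
  calc Real.exp (β * c) * partition H β
      ≤ Real.exp (β * c) * (Real.exp (-β * c) * partition (H - G) β) :=
        mul_le_mul_of_nonneg_left h4 (Real.exp_nonneg _)
    _ = partition (H - G) β := by
        rw [← mul_assoc, ← Real.exp_add, neg_mul, add_neg_cancel, Real.exp_zero, one_mul]

/-! ### The Bose-Hubbard Hamiltonian -/

/-- The Bose-Hubbard Hamiltonian with the hopping amplitudes `J` on the edges `E`. -/
def ham (E : Finset (Sym2 V)) (J : Sym2 V → ℝ) (U μ : V → ℝ) : Module.End ℂ (Core V) :=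
  -(∑ e ∈ E, (J e : ℂ) • hopping e) +
    ∑ x : V, (((U x / 2 : ℝ) : ℂ) • (number x * (number x - 1)) - (μ x : ℂ) • number x)

/-- The on-site energy of an occupation number state. -/
def onsite (U μ : V → ℝ) (n : V → ℕ) : ℝ :=
  ∑ x : V, (U x / 2 * (n x * (n x - 1)) - μ x * n x)

theorem onsite_ket (U μ : V → ℝ) (n : V → ℕ) :
    (∑ x : V, (((U x / 2 : ℝ) : ℂ) • (number x * (number x - 1)) - (μ x : ℂ) • number x))
      (ket n) = (onsite U μ n : ℂ) • ket n := by
  rw [LinearMap.sum_apply, onsite, Complex.ofReal_sum, Finset.sum_smul]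
  refine Finset.sum_congr rfl fun x _ => ?_
  simp only [LinearMap.sub_apply, LinearMap.smul_apply, Module.End.mul_apply, number_ket,
    Module.End.one_apply, map_sub, map_smul, smul_smul, ← sub_smul]
  congr 1
  push_cast
  ring

variable (E : Finset (Sym2 V)) (J J' : Sym2 V → ℝ) (U μ μ' : V → ℝ)

theorem adjoint_ham : Adjoint (ham E J U μ) (ham E J U μ) :=
  (Adjoint.sum E fun e _ => (adjoint_hopping e).real_smul _).neg.add
    (adjoint_of_diag (onsite_ket U μ))

theorem conserves_total_ham : Conserves total (ham E J U μ) :=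
  (Conserves.sum E fun e _ => (conserves_total_hopping e).smul _).neg.add
    (conserves_of_diag _ (onsite_ket U μ))

/-- The number of particles at `x` is conserved if there is no hopping to and from `x`. -/
theorem conserves_ham {x : V} (hx : ∀ e ∈ E, x ∈ e → J e = 0) :
    Conserves (fun n : V → ℕ => n x) (ham E J U μ) := by
  refine (Conserves.sum E fun e he => ?_).neg.add (conserves_of_diag _ (onsite_ket U μ))
  by_cases hxe : x ∈ e
  · rw [hx e he hxe]
    simpa using conserves_zero
  · exact (conserves_hopping hxe).smul _

theorem nonempty_eigenResolution_ham : Nonempty (EigenResolution (ham E J U μ)) :=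
  exists_eigenResolution (adjoint_ham E J U μ) (conserves_total_ham E J U μ)

/-- A choice of eigenvectors of the Hamiltonian. -/
def hamRes : EigenResolution (ham E J U μ) := (nonempty_eigenResolution_ham E J U μ).some

theorem ham_sub_ham : ham E J U μ - ham E J' U μ' =
    -(∑ e ∈ E, ((J e - J' e : ℝ) : ℂ) • hopping e) -
      ∑ z, ((μ z - μ' z : ℝ) : ℂ) • number z := by
  refine LinearMap.ext fun f => ?_
  simp only [ham, LinearMap.add_apply, LinearMap.sub_apply, LinearMap.neg_apply,
    LinearMap.sum_apply, LinearMap.smul_apply, Complex.ofReal_sub, sub_smul,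
    Finset.sum_sub_distrib]
  abel

theorem re_ip_number_nonneg (z : V) (f : Core V) : 0 ≤ (ip f (number z f)).re := by
  rw [ip_diag (d := fun n => (n z : ℝ)) (by simpa using number_ket z) f (subset_refl _),
    Complex.ofReal_re]
  positivity

/-! ### Comparison of Hamiltonians as quadratic forms -/

variable {E J J' U μ μ'}

/-- Each change of a hopping amplitude costs at most |J_e - J'_e| times the particle number on the
edge. Regrouped by sites, this cost is absorbed by the difference of the chemical potentials. -/
theorem ip_ham_sub_ham_nonneg (hE : ∀ e ∈ E, ¬ e.IsDiag)
    (h : ∀ z, ∑ e ∈ E with z ∈ e, |J e - J' e| ≤ μ z - μ' z) (f : Core V) :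
    (ip f ((ham E J U μ - ham E J' U μ') f)).re ≤ 0 := by
  rw [ham_sub_ham, LinearMap.sub_apply, LinearMap.neg_apply, ip_sub_right, ip_neg_right,
    LinearMap.sum_apply, LinearMap.sum_apply, ip_sum_right, ip_sum_right]
  simp only [LinearMap.smul_apply, ip_smul_right, Complex.sub_re, Complex.neg_re, Complex.re_sum,
    Complex.re_ofReal_mul]
  have h1 : -∑ e ∈ E, (J e - J' e) * (ip f (hopping e f)).re ≤
      ∑ e ∈ E, |J e - J' e| * ∑ z with z ∈ e, (ip f (number z f)).re := by
    rw [← Finset.sum_neg_distrib]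
    refine Finset.sum_le_sum fun e he => ?_
    calc -((J e - J' e) * (ip f (hopping e f)).re)
        ≤ |(J e - J' e) * (ip f (hopping e f)).re| := neg_le_abs _
      _ = |J e - J' e| * |(ip f (hopping e f)).re| := abs_mul _ _
      _ ≤ _ := mul_le_mul_of_nonneg_left (abs_re_ip_hopping_le (hE e he) f) (abs_nonneg _)
  have h2 : ∑ e ∈ E, |J e - J' e| * ∑ z with z ∈ e, (ip f (number z f)).re =
      ∑ z, (∑ e ∈ E with z ∈ e, |J e - J' e|) * (ip f (number z f)).re := by
    simp only [Finset.mul_sum, Finset.sum_mul, Finset.sum_filter]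
    rw [Finset.sum_comm]
    refine Finset.sum_congr rfl fun z _ => Finset.sum_congr rfl fun e _ => ?_
    by_cases hz : z ∈ e <;> simp [hz]
  have h3 : ∑ z, (∑ e ∈ E with z ∈ e, |J e - J' e|) * (ip f (number z f)).re ≤
      ∑ z, (μ z - μ' z) * (ip f (number z f)).re :=
    Finset.sum_le_sum fun z _ => mul_le_mul_of_nonneg_right (h z) (re_ip_number_nonneg z f)
  linarith

/-- By the form inequality the linear term in Klein's inequality has the favourable sign and can be
dropped. -/
theorem sum_weight_ham_le (hE : ∀ e ∈ E, ¬ e.IsDiag)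
    (h : ∀ z, ∑ e ∈ E with z ∈ e, |J e - J' e| ≤ μ z - μ' z) {β : ℝ} (hβ : 0 ≤ β) (N : ℕ) :
    ∑ n ∈ sector N, weight (ham E J' U μ') β n ≤ ∑ n ∈ sector N, weight (ham E J U μ) β n := by
  refine le_trans ?_
    (EigenResolution.sum_weight_sub_le (hamRes E J U μ) (hamRes E J' U μ') β N)
  rw [(hamRes E J' U μ').sectorTrace_eq, Complex.re_sum]
  have : ∑ i ∈ sector N, ((Real.exp (-β * (hamRes E J' U μ').ev i) : ℂ) *
      ip ((hamRes E J' U μ').vec i)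
        ((ham E J U μ - ham E J' U μ') ((hamRes E J' U μ').vec i))).re ≤ 0 := by
    refine Finset.sum_nonpos fun i _ => ?_
    rw [Complex.re_ofReal_mul]
    exact mul_nonpos_of_nonneg_of_nonpos (Real.exp_nonneg _) (ip_ham_sub_ham_nonneg hE h _)
  nlinarith

/-- The on-site energy grows faster than linearly in the number of particles. -/
theorem exists_le_onsite (hU : ∀ x, 0 < U x) (μ : V → ℝ) (a : ℝ) :
    ∃ C, ∀ n, a * total n - C ≤ onsite U μ n := by
  -- The constant left over from completing the square at each site.
  refine ⟨∑ x, (U x / 2 + μ x + a) ^ 2 / (2 * U x), fun n => ?_⟩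
  rw [onsite, total, Nat.cast_sum, Finset.mul_sum, ← Finset.sum_sub_distrib]
  refine Finset.sum_le_sum fun x _ => ?_
  have hx := hU x
  have h : (U x / 2 * (n x * (n x - 1)) - μ x * n x) -
      (a * n x - (U x / 2 + μ x + a) ^ 2 / (2 * U x)) =
      (U x * n x - (U x / 2 + μ x + a)) ^ 2 / (2 * U x) := by
    field_simp
    ring
  have : 0 ≤ (U x * n x - (U x / 2 + μ x + a)) ^ 2 / (2 * U x) := by positivity
  linarith

theorem ham_zero_ket (n : V → ℕ) : ham E 0 U μ (ket n) = (onsite U μ n : ℂ) • ket n := by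
  rw [ham, LinearMap.add_apply, onsite_ket]
  simp

theorem weight_ham_zero (β : ℝ) (n : V → ℕ) :
    weight (ham E 0 U μ) β n = Real.exp (-β * onsite U μ n) := by
  have hk : ∀ k : ℕ, ((ham E 0 U μ) ^ k) (ket n) = (((onsite U μ n) ^ k : ℝ) : ℂ) • ket n := by
    intro k
    induction k with
    | zero => simp
    | succ k ih =>
      rw [pow_succ', Module.End.mul_apply, ih, map_smul, ham_zero_ket, smul_smul,
        ← Complex.ofReal_mul, pow_succ]
  have h1 := NormedSpace.expSeries_div_hasSum_exp (-β * onsite U μ n)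
  rw [← Real.exp_eq_exp_ℝ, ← Complex.hasSum_ofReal] at h1
  rw [weight, expMatrix]
  rw [← Complex.ofReal_re (Real.exp _), ← h1.tsum_eq]
  congr 1
  refine tsum_congr fun k => ?_
  rw [hk, Finsupp.smul_apply, ket_apply, if_pos rfl, mul_pow]
  simp only [smul_eq_mul]
  push_cast
  ring

/-! ### Trading all hopping for chemical potential: summability and existence of e^{-βH} -/

variable (E J U μ)

/-- The total hopping amplitude at a site. -/
def strength (z : V) : ℝ := ∑ e ∈ E with z ∈ e, |J e|

variable {E J U μ}

/-- Reduces convergence questions to a classical gas with explicit weights. -/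
theorem sum_weight_ham_le_onsite (hE : ∀ e ∈ E, ¬ e.IsDiag) {β : ℝ} (hβ : 0 ≤ β) (N : ℕ) :
    ∑ n ∈ sector N, weight (ham E J U μ) β n ≤
      ∑ n ∈ sector N, Real.exp (-β * onsite U (fun z => μ z + strength E J z) n) := by
  have := sum_weight_ham_le (J := 0) (J' := J) (U := U) (μ := fun z => μ z + strength E J z)
    (μ' := μ) hE (by intro z; simp [strength]) hβ N
  simpa only [weight_ham_zero] using this

theorem summable_total_mul_weight_ham (hE : ∀ e ∈ E, ¬ e.IsDiag) (hU : ∀ x, 0 < U x) {β : ℝ}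
    (hβ : 0 < β) : Summable fun n => (1 + total n : ℝ) * weight (ham E J U μ) β n := by
  -- Slope 2/β gives decay e^{-2 total}: one factor e^{-total} absorbs 1 + total, the other is
  -- summable.
  obtain ⟨C, hC⟩ := exists_le_onsite hU (fun z => μ z + strength E J z) (2 / β)
  refine summable_of_sector (g := fun n => Real.exp (β * C) * Real.exp (-(total n : ℝ)))
    (fun n => mul_nonneg (by positivity) ((hamRes E J U μ).weight_nonneg β n))
    (fun n => by positivity) (summable_exp_neg_total.mul_left _) fun N => ?_
  calc ∑ n ∈ sector N, (1 + total n : ℝ) * weight (ham E J U μ) β n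
      = (1 + N) * ∑ n ∈ sector N, weight (ham E J U μ) β n := by
        rw [Finset.mul_sum]
        exact Finset.sum_congr rfl fun n hn => by rw [mem_sector.1 hn]
    _ ≤ (1 + N) * ∑ n ∈ sector N, Real.exp (-β * onsite U (fun z => μ z + strength E J z) n) :=
        mul_le_mul_of_nonneg_left (sum_weight_ham_le_onsite hE hβ.le N) (by positivity)
    _ ≤ _ := by
        rw [Finset.mul_sum]
        refine Finset.sum_le_sum fun n hn => ?_
        rw [← mem_sector.1 hn]
        have h1 : (1 + total n : ℝ) ≤ Real.exp (total n) := by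
          linarith [Real.add_one_le_exp (total n : ℝ)]
        have h2 : -β * onsite U (fun z => μ z + strength E J z) n ≤ β * C - 2 * total n := by
          have := mul_le_mul_of_nonneg_left (hC n) hβ.le
          have e : β * (2 / β * total n - C) = 2 * total n - β * C := by field_simp
          linarith
        calc (1 + total n : ℝ) * Real.exp (-β * onsite U (fun z => μ z + strength E J z) n)
            ≤ Real.exp (total n) * Real.exp (β * C - 2 * total n) :=
              mul_le_mul h1 (Real.exp_le_exp.2 h2) (Real.exp_nonneg _) (Real.exp_nonneg _)
          _ = _ := by rw [← Real.exp_add, ← Real.exp_add]; ring_nf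

theorem summable_weight_ham (hE : ∀ e ∈ E, ¬ e.IsDiag) (hU : ∀ x, 0 < U x) {β : ℝ}
    (hβ : 0 < β) : Summable (weight (ham E J U μ) β) := by
  refine (summable_total_mul_weight_ham (J := J) (μ := μ) hE hU hβ).of_nonneg_of_le
    ((hamRes E J U μ).weight_nonneg β) fun n => ?_
  exact le_mul_of_one_le_left ((hamRes E J U μ).weight_nonneg β n) (by simp)

theorem summable_number_mul_weight_ham (hE : ∀ e ∈ E, ¬ e.IsDiag) (hU : ∀ x, 0 < U x) {β : ℝ}
    (hβ : 0 < β) (z : V) : Summable fun n => (n z : ℝ) * weight (ham E J U μ) β n := by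
  refine (summable_total_mul_weight_ham (J := J) (μ := μ) hE hU hβ).of_nonneg_of_le
    (fun n => mul_nonneg (by positivity) ((hamRes E J U μ).weight_nonneg β n)) fun n => ?_
  refine mul_le_mul_of_nonneg_right ?_ ((hamRes E J U μ).weight_nonneg β n)
  have h2 : n z ≤ total n :=
    Finset.single_le_sum (f := n) (fun _ _ => Nat.zero_le _) (Finset.mem_univ z)
  have : (n z : ℝ) ≤ total n := by exact_mod_cast h2
  linarith

theorem exists_isBoltzmann_ham (hE : ∀ e ∈ E, ¬ e.IsDiag) (hU : ∀ x, 0 < U x) {β : ℝ}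
    (hβ : 0 < β) :
    ∃ T : FockSpace V →L[ℂ] FockSpace V, IsBoltzmann (ham E J U μ) β T := by
  -- Slope 0 suffices here: boundedness only needs the eigenvalues bounded below by -C, which
  -- follows by testing the form inequality on eigenvectors.
  obtain ⟨C, hC⟩ := exists_le_onsite hU (fun z => μ z + strength E J z) 0
  have hR := hamRes E J U μ
  refine hR.exists_isBoltzmann (Real.exp_nonneg (β * C)) fun i => ?_
  refine Real.exp_le_exp.2 ?_
  have h1 := ip_ham_sub_ham_nonneg (J := 0) (J' := J) (U := U)
    (μ := fun z => μ z + strength E J z) (μ' := μ) hE (by intro z; simp [strength]) (hR.vec i)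
  have h2 : ip (hR.vec i) (ham E J U μ (hR.vec i)) = hR.ev i := by
    rw [hR.eig, ip_smul_right, hR.ip_vec_self, mul_one]
  have h3 := ip_diag (ham_zero_ket (E := E) (U := U) (μ := fun z => μ z + strength E J z))
    (hR.vec i) (s := sector (total i)) (by
      intro n hn
      by_contra hns
      exact Finsupp.mem_support_iff.1 hn (hR.supp i n (by simpa using hns)))
  rw [LinearMap.sub_apply, ip_sub_right, h2, h3, ← Complex.ofReal_sub, Complex.ofReal_re] at h1
  have h4 : -C ≤ ∑ n ∈ sector (total i),
      onsite U (fun z => μ z + strength E J z) n * ‖hR.vec i n‖ ^ 2 := by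
    calc -C = ∑ n ∈ sector (total i), -C * ‖hR.vec i n‖ ^ 2 := by
          rw [← Finset.mul_sum, hR.sum_norm_vec_sq, mul_one]
      _ ≤ _ := by
          refine Finset.sum_le_sum fun n _ => mul_le_mul_of_nonneg_right ?_ (by positivity)
          simpa using hC n
  nlinarith

/-- The mean occupation number of a site. -/
def occupation (H : Module.End ℂ (Core V)) (β : ℝ) (z : V) : ℝ :=
  average H β fun n => (n z : ℝ)

theorem occupation_nonneg (β : ℝ) (z : V) : 0 ≤ occupation (ham E J U μ) β z :=
  div_nonneg
    (tsum_nonneg fun n => mul_nonneg (by positivity) ((hamRes E J U μ).weight_nonneg β n))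
    (tsum_nonneg fun n => (hamRes E J U μ).weight_nonneg β n)

/-- The Peierls-Bogoliubov inequality for the perturbation ∑ a_z n_z. The sign of `a` is free: it
serves both to raise and to lower chemical potentials. -/
theorem exp_occupation_mul_partition_le (hE : ∀ e ∈ E, ¬ e.IsDiag) (hU : ∀ x, 0 < U x) {β : ℝ}
    (hβ : 0 < β) (a : V → ℝ) :
    Real.exp (β * ∑ z, a z * occupation (ham E J U μ) β z) * partition (ham E J U μ) β ≤
      partition (ham E J U (fun z => μ z + a z)) β := by
  have hG : ∀ n, (∑ z, (a z : ℂ) • number z) (ket n) = ((∑ z, a z * n z : ℝ) : ℂ) • ket n := by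
    intro n
    rw [LinearMap.sum_apply, Complex.ofReal_sum, Finset.sum_smul]
    refine Finset.sum_congr rfl fun z _ => ?_
    rw [LinearMap.smul_apply, number_ket, smul_smul]
    push_cast
    rfl
  have hH : ham E J U (fun z => μ z + a z) = ham E J U μ - ∑ z, (a z : ℂ) • number z := by
    have h := ham_sub_ham E J J U (fun z => μ z + a z) μ
    refine LinearMap.ext fun f => ?_
    have h' := LinearMap.congr_fun h f
    simp only [LinearMap.sub_apply, LinearMap.neg_apply, LinearMap.sum_apply,
      LinearMap.smul_apply, LinearMap.zero_apply, sub_self, Complex.ofReal_zero, zero_smul,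
      Finset.sum_const_zero,
      neg_zero, add_sub_cancel_left, zero_sub] at h' ⊢
    rw [sub_eq_iff_eq_add'.1 h']
    abel
  have hn := fun z => summable_number_mul_weight_ham (J := J) (μ := μ) hE hU hβ z
  have hg : (fun n : V → ℕ => (∑ z, a z * n z) * weight (ham E J U μ) β n) =
      fun n => ∑ z, a z * (n z * weight (ham E J U μ) β n) := by
    funext n
    rw [Finset.sum_mul]
    exact Finset.sum_congr rfl fun z _ => mul_assoc _ _ _
  have hav : average (ham E J U μ) β (fun n => ∑ z, a z * n z) =
      ∑ z, a z * occupation (ham E J U μ) β z := by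
    simp only [occupation, average]
    rw [hg, Summable.tsum_finsetSum fun z _ => (hn z).mul_left _, Finset.sum_div]
    refine Finset.sum_congr rfl fun z _ => ?_
    rw [tsum_mul_left, mul_div_assoc]
  have hR := hamRes E J U (fun z => μ z + a z)
  have h1 := adjoint_ham E J U (fun z => μ z + a z)
  have h2 := conserves_total_ham E J U (fun z => μ z + a z)
  have h3 := summable_weight_ham (J := J) (μ := fun z => μ z + a z) hE hU hβ
  rw [hH] at hR h1 h2 h3 ⊢
  rw [← hav]
  refine exp_average_mul_partition_le (hamRes E J U μ) hR hG (summable_weight_ham hE hU hβ) h3 ?_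
    h1 h2
  rw [hg]
  exact summable_sum fun z _ => (hn z).mul_left _

/-- Removing the hopping to and from a site does not increase the partition function. -/
theorem partition_le_of_remove (hE : ∀ e ∈ E, ¬ e.IsDiag) (hU : ∀ x, 0 < U x) {β : ℝ}
    (hβ : 0 < β) (x : V) :
    partition (ham E (fun e => if x ∈ e then 0 else J e) U μ) β ≤ partition (ham E J U μ) β := by
  set J₀ : Sym2 V → ℝ := fun e => if x ∈ e then 0 else J e with hJ₀
  refine tsum_le_tsum_of_sector (summable_weight_ham hE hU hβ) (summable_weight_ham hE hU hβ) ?_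
  intro N
  have h := EigenResolution.sum_weight_sub_le (hamRes E J U μ) (hamRes E J₀ U μ) β N
  -- The deleted hopping terms change n_x, whereas the exponential of the reduced Hamiltonian
  -- conserves it, so one factor of every summand vanishes.
  have h0 : sectorTrace (ham E J₀ U μ) β (ham E J U μ - ham E J₀ U μ) N = 0 := by
    refine Finset.sum_eq_zero fun m _ => Finset.sum_eq_zero fun n _ => ?_
    by_cases hmn : m x = n x
    · rw [ham_sub_ham]
      simp only [LinearMap.sub_apply, LinearMap.neg_apply, LinearMap.sum_apply,
        LinearMap.smul_apply, LinearMap.zero_apply, sub_self, Complex.ofReal_zero, zero_smul,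
      Finset.sum_const_zero,
        sub_zero, Finsupp.neg_apply, Finsupp.finsetSum_apply, Finsupp.smul_apply]
      rw [Finset.sum_eq_zero, neg_zero, zero_mul]
      intro e he
      by_cases hx : x ∈ e
      · rw [hopping_ket_eq_zero (hE e he) hx hmn, smul_zero]
      · simp [hJ₀, hx]
    · rw [conserves_expMatrix (conserves_ham E J₀ U μ (x := x)
        (fun e _ hx => by simp [hJ₀, hx])) β (Ne.symm hmn), mul_zero]
  rw [h0] at h
  simpa using h

end Hamiltonian

section Model

variable {E : Finset (Sym2 V)} {J : Sym2 V → ℝ} {U μ : V → ℝ}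

/-! ### A site without hopping -/

/-- The operator `|n⟩ ↦ |n + δ_x⟩`. -/
def addParticle (x : V) : Module.End ℂ (Core V) :=
  Finsupp.lmapDomain ℂ ℂ (fun n : V → ℕ => n + Pi.single x 1)

theorem addParticle_ket (x : V) (n : V → ℕ) : addParticle x (ket n) = ket (n + Pi.single x 1) := by
  simp [addParticle, ket, Finsupp.mapDomain_single]

theorem addParticle_apply (x : V) (f : Core V) (n : V → ℕ) :
    addParticle x f (n + Pi.single x 1) = f n :=
  Finsupp.mapDomain_apply (add_left_injective (Pi.single x 1 : V → ℕ)) f n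

theorem commute_annihilation_addParticle {x y : V} (h : y ≠ x) :
    Commute (annihilation y) (addParticle x) := by
  refine end_ext fun n => ?_
  rw [Module.End.mul_apply, Module.End.mul_apply, addParticle_ket, annihilation_ket,
    annihilation_ket, map_smul, addParticle_ket]
  have h1 : n + Pi.single x 1 - Pi.single y 1 = n - Pi.single y 1 + Pi.single x 1 := by
    ext z
    by_cases hz : z = y
    · subst hz; simp [h]
    · simp [hz]
  rw [h1]
  simp [h]

theorem commute_creation_addParticle {x y : V} (h : y ≠ x) :
    Commute (creation y) (addParticle x) := by
  refine end_ext fun n => ?_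
  rw [Module.End.mul_apply, Module.End.mul_apply, addParticle_ket, creation_ket,
    creation_ket, map_smul, addParticle_ket, add_right_comm]
  simp [h]

theorem commute_hopping_addParticle {e : Sym2 V} {x : V} (h : x ∉ e) :
    Commute (hopping e) (addParticle x) := by
  induction e with | _ y z => ?_
  simp only [Sym2.mem_iff, not_or] at h
  have hy := Ne.symm h.1
  have hz := Ne.symm h.2
  exact ((commute_creation_addParticle hy).mul_left (commute_annihilation_addParticle hz)).add_left
    ((commute_creation_addParticle hz).mul_left (commute_annihilation_addParticle hy))

theorem onsite_add_single (U μ : V → ℝ) (n : V → ℕ) (x : V) :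
    onsite U μ (n + Pi.single x 1) = onsite U μ n + (U x * n x - μ x) := by
  rw [onsite, onsite, ← Finset.add_sum_erase _ _ (Finset.mem_univ x),
    ← Finset.add_sum_erase (Finset.univ) (fun z => U z / 2 * (n z * ((n z : ℝ) - 1)) - μ z * n z)
      (Finset.mem_univ x)]
  have h : ∀ z ∈ Finset.univ.erase x,
      U z / 2 * (((n + Pi.single x 1 : V → ℕ) z : ℝ) * (((n + Pi.single x 1 : V → ℕ) z : ℝ) - 1)) -
        μ z * ((n + Pi.single x 1 : V → ℕ) z : ℝ) =
      U z / 2 * (n z * ((n z : ℝ) - 1)) - μ z * n z := by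
    intro z hz
    simp [Finset.ne_of_mem_erase hz]
  rw [Finset.sum_congr rfl h]
  simp only [Pi.add_apply, Pi.single_eq_same]
  push_cast
  ring

/-- Adding a particle at an isolated site commutes with all remaining hopping and, at fixed
occupation j, raises the on-site energy by the constant U_x j - μ_x. -/
theorem ham_addParticle {x : V} (hx : ∀ e ∈ E, x ∈ e → J e = 0) (f : Core V) (j : ℕ)
    (hf : ∀ n, n x ≠ j → f n = 0) :
    ham E J U μ (addParticle x f) = addParticle x
      ((ham E J U μ + ((U x * j - μ x : ℝ) : ℂ) • (1 : Module.End ℂ (Core V))) f) := by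
  have hs := eq_sum_ket (f := f) (s := f.support) (fun n hn => Finsupp.notMem_support_iff.1 hn)
  rw [hs]
  simp only [map_sum, map_smul]
  refine Finset.sum_congr rfl fun n hn => ?_
  congr 1
  have hnj : n x = j := by
    by_contra h
    exact Finsupp.mem_support_iff.1 hn (hf n h)
  rw [ham, LinearMap.add_apply, LinearMap.add_apply, LinearMap.add_apply, addParticle_ket,
    onsite_ket, onsite_ket, LinearMap.neg_apply, LinearMap.neg_apply, LinearMap.sum_apply,
    LinearMap.sum_apply, onsite_add_single, hnj, LinearMap.smul_apply, Module.End.one_apply,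
    map_add, map_add, map_neg, map_sum, map_smul, map_smul, addParticle_ket, add_assoc, ← add_smul,
    ← Complex.ofReal_add]
  congr 2
  refine Finset.sum_congr rfl fun e he => ?_
  by_cases hxe : x ∈ e
  · simp [hx e he hxe]
  · rw [LinearMap.smul_apply, LinearMap.smul_apply, map_smul]
    congr 1
    have := LinearMap.congr_fun (commute_hopping_addParticle hxe).eq (ket n)
    rwa [Module.End.mul_apply, Module.End.mul_apply, addParticle_ket] at this

/-- Powers of H preserve n_x, so the energy increment stays constant along the exponential series
and factors out. This recursion replaces a tensor factorisation of the Gibbs state. -/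
theorem weight_add_single {x : V} (hx : ∀ e ∈ E, x ∈ e → J e = 0) (β : ℝ) (n : V → ℕ) :
    weight (ham E J U μ) β (n + Pi.single x 1) =
      Real.exp (-β * (U x * n x - μ x)) * weight (ham E J U μ) β n := by
  set c := U x * n x - μ x with hc
  have hcons : Conserves (fun n : V → ℕ => n x)
      (ham E J U μ + (c : ℂ) • (1 : Module.End ℂ (Core V))) :=
    (conserves_ham E J U μ hx).add (conserves_one.smul _)
  have hk : ∀ k : ℕ, ((ham E J U μ) ^ k) (ket (n + Pi.single x 1)) = addParticle x
      (((ham E J U μ + (c : ℂ) • (1 : Module.End ℂ (Core V))) ^ k) (ket n)) := by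
    intro k
    induction k with
    | zero => simp [addParticle_ket]
    | succ k ih =>
      rw [pow_succ', Module.End.mul_apply, ih, ham_addParticle hx _ (n x), pow_succ',
        Module.End.mul_apply]
      exact fun m hm => hcons.pow k m n hm
  have h1 := (hamRes E J U μ).expMatrix_add β c n n
  rw [weight, weight, ← Complex.re_ofReal_mul, ← h1, expMatrix, expMatrix]
  simp only [hk, addParticle_apply]

theorem weight_add_single_nat {x : V} (hx : ∀ e ∈ E, x ∈ e → J e = 0) (β : ℝ) (n : V → ℕ)
    (k : ℕ) : weight (ham E J U μ) β (n + Pi.single x k) =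
      Real.exp (-β * (U x * (k * n x + k * (k - 1) / 2) - μ x * k)) *
        weight (ham E J U μ) β n := by
  induction k with
  | zero => simp
  | succ k ih =>
    have e : n + Pi.single x (k + 1) = n + Pi.single x k + Pi.single x 1 := by
      rw [add_assoc, ← Pi.single_add]
    rw [e, weight_add_single hx, ih, ← mul_assoc, ← Real.exp_add]
    congr 2
    simp only [Pi.add_apply, Pi.single_eq_same]
    push_cast
    ring

theorem occupation_mul_partition (hE : ∀ e ∈ E, ¬ e.IsDiag) (hU : ∀ x, 0 < U x) {β : ℝ}
    (hβ : 0 < β) (x : V) : ∑' n, (n x : ℝ) * weight (ham E J U μ) β n =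
      occupation (ham E J U μ) β x * partition (ham E J U μ) β := by
  rw [occupation, average, div_mul_cancel₀]
  exact (partition_pos (hamRes E J U μ) (summable_weight_ham hE hU hβ)).ne'

/-- The occupation of a site without hopping is at most of order `β^(-1/2)`. -/
theorem occupation_le_of_isolated (hE : ∀ e ∈ E, ¬ e.IsDiag) {u : ℝ} (hu : 0 < u)
    (hU : ∀ x, u ≤ U x) {β : ℝ} (hβ : 0 < β) (hβ1 : Real.sqrt β ≤ 1) {x : V}
    (hx : ∀ e ∈ E, x ∈ e → J e = 0) (hμ : μ x ≤ 2 / Real.sqrt β) :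
    occupation (ham E J U μ) β x ≤ (3 / u + 2) / Real.sqrt β := by
  set s := Real.sqrt β with hs
  have hs0 : 0 < s := Real.sqrt_pos.2 hβ
  have hss : s * s = β := Real.mul_self_sqrt hβ.le
  have hU0 : ∀ x, 0 < U x := fun x => hu.trans_le (hU x)
  set w := weight (ham E J U μ) β with hw
  have hw0 : ∀ n, 0 ≤ w n := (hamRes E J U μ).weight_nonneg β
  have hsw : Summable w := summable_weight_ham hE hU0 hβ
  have hsn := summable_number_mul_weight_ham (J := J) (μ := μ) hE hU0 hβ x
  have hZ := partition_pos (hamRes E J U μ) hsw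
  -- From K particles on, U_x n_x ≥ 3/s exceeds μ_x ≤ 2/s by at least 1/s, so each further particle
  -- multiplies the weight by at most e^{-β/s} = e^{-s}.
  set K := ⌈3 / (u * s)⌉₊ with hK
  have hK1 : 3 / (u * s) ≤ K := Nat.le_ceil _
  have hK2 : (K : ℝ) < 3 / (u * s) + 1 := Nat.ceil_lt_add_one (by positivity)
  -- The weighted excess over K, with truncated subtraction. It vanishes at n_x = 0, so shifting by
  -- one particle loses nothing in the sum.
  let φ : (V → ℕ) → ℝ := fun n => ((n x - K : ℕ) : ℝ) * w n
  have hφ : Summable φ := by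
    refine hsn.of_nonneg_of_le (fun n => mul_nonneg (by positivity) (hw0 n)) fun n => ?_
    refine mul_le_mul_of_nonneg_right ?_ (hw0 n)
    exact_mod_cast Nat.sub_le _ _
  have hinj : Function.Injective fun n : V → ℕ => n + (Pi.single x 1 : V → ℕ) :=
    add_left_injective _
  have hshift : ∑' n, φ (n + (Pi.single x 1 : V → ℕ)) = ∑' n, φ n := by
    refine hinj.tsum_eq (f := φ) fun n hn => ?_
    have hnx : n x ≠ 0 := by
      intro h0
      apply hn
      simp [φ, h0]
    exact ⟨n - (Pi.single x 1 : V → ℕ), sub_single_add_single hnx⟩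
  -- Summed over n this reads e^s F ≤ F + Z, hence F ≤ Z/s: the mean excess over K is at most 1/s.
  have hstep : ∀ n, Real.exp s * φ (n + (Pi.single x 1 : V → ℕ)) ≤ φ n + w n := by
    intro n
    simp only [φ, Pi.add_apply, Pi.single_eq_same]
    by_cases hn : n x < K
    · rw [Nat.sub_eq_zero_of_le (by omega : n x + 1 ≤ K), Nat.sub_eq_zero_of_le hn.le]
      simpa using hw0 n
    · push Not at hn
      rw [hw, weight_add_single hx, ← hw, show n x + 1 - K = n x - K + 1 by omega]
      have h1 : s ≤ β * (U x * n x - μ x) := by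
        have h2 : (K : ℝ) ≤ n x := by exact_mod_cast hn
        have h3 : 3 / s ≤ U x * n x := by
          calc 3 / s = u * (3 / (u * s)) := by field_simp
            _ ≤ u * n x := mul_le_mul_of_nonneg_left (hK1.trans h2) hu.le
            _ ≤ U x * n x := mul_le_mul_of_nonneg_right (hU x) (by positivity)
        have h4 : 1 / s ≤ U x * n x - μ x := by
          have : 3 / s = 2 / s + 1 / s := by ring
          linarith
        calc s = β * (1 / s) := by rw [← hss]; field_simp
          _ ≤ _ := mul_le_mul_of_nonneg_left h4 hβ.le
      have h5 : Real.exp s * Real.exp (-β * (U x * n x - μ x)) ≤ 1 := by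
        rw [← Real.exp_add, Real.exp_le_one_iff]
        linarith
      have h6 : 0 ≤ ((n x - K : ℕ) + 1 : ℝ) * w n := mul_nonneg (by positivity) (hw0 n)
      push_cast
      calc Real.exp s * (((n x - K : ℕ) + 1 : ℝ) * (Real.exp (-β * (U x * n x - μ x)) * w n))
          = Real.exp s * Real.exp (-β * (U x * n x - μ x)) * (((n x - K : ℕ) + 1 : ℝ) * w n) := by
            ring
        _ ≤ 1 * (((n x - K : ℕ) + 1 : ℝ) * w n) := mul_le_mul_of_nonneg_right h5 h6
        _ = _ := by ring
  have hF : Real.exp s * ∑' n, φ n ≤ ∑' n, φ n + partition (ham E J U μ) β := by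
    have h := Summable.tsum_le_tsum hstep ((hφ.comp_injective hinj).mul_left _) (hφ.add hsw)
    rw [tsum_mul_left, hφ.tsum_add hsw, hshift] at h
    exact h
  have hF0 : 0 ≤ ∑' n, φ n := tsum_nonneg fun n => mul_nonneg (by positivity) (hw0 n)
  have hF1 : s * ∑' n, φ n ≤ partition (ham E J U μ) β := by
    have := mul_le_mul_of_nonneg_right (Real.add_one_le_exp s) hF0
    linarith
  have hN : occupation (ham E J U μ) β x * partition (ham E J U μ) β ≤
      K * partition (ham E J U μ) β + ∑' n, φ n := by
    rw [← occupation_mul_partition hE hU0 hβ, partition, ← tsum_mul_left,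
      ← (hsw.mul_left _).tsum_add hφ]
    refine Summable.tsum_le_tsum (fun n => ?_) hsn ((hsw.mul_left _).add hφ)
    rw [← add_mul]
    refine mul_le_mul_of_nonneg_right ?_ (hw0 n)
    have : n x ≤ K + (n x - K) := by omega
    exact_mod_cast this
  have hF2 : ∑' n, φ n ≤ partition (ham E J U μ) β / s := by
    rw [le_div_iff₀ hs0]
    linarith
  have h1 : occupation (ham E J U μ) β x ≤ K + 1 / s := by
    refine le_of_mul_le_mul_right ?_ hZ
    calc _ ≤ _ := hN
      _ ≤ K * partition (ham E J U μ) β + partition (ham E J U μ) β / s := by linarith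
      _ = _ := by ring
  have h2 : (1 : ℝ) ≤ 1 / s := by rwa [le_div_iff₀ hs0, one_mul]
  calc occupation (ham E J U μ) β x ≤ 3 / (u * s) + 1 / s + 1 / s := by linarith
    _ = _ := by field_simp; ring

/-- The occupation of a site without hopping is at least of order `β^(-1/2)`. -/
theorem le_occupation_of_isolated (hE : ∀ e ∈ E, ¬ e.IsDiag) (hU : ∀ x, 0 < U x) {β : ℝ}
    (hβ : 0 < β) {x : V} (hx : ∀ e ∈ E, x ∈ e → J e = 0) (L : ℕ) :
    L * (1 - β * (U x * (L * occupation (ham E J U μ) β x + L * L / 2) + |μ x| * L)) ≤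
      occupation (ham E J U μ) β x := by
  set w := weight (ham E J U μ) β with hw
  have hw0 : ∀ n, 0 ≤ w n := (hamRes E J U μ).weight_nonneg β
  have hsw : Summable w := summable_weight_ham hE hU hβ
  have hsn := summable_number_mul_weight_ham (J := J) (μ := μ) hE hU hβ x
  have hZ := partition_pos (hamRes E J U μ) hsw
  have hinj : Function.Injective fun n : V → ℕ => n + (Pi.single x L : V → ℕ) :=
    add_left_injective _
  -- Adding L particles multiplies the weight by an explicit exponential, bounded below by its
  -- tangent line; the part linear in n_x is kept apart so that it sums to the occupation.
  have hstep : ∀ n, L * (1 - β * (U x * (L * L / 2) + |μ x| * L)) * w n -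
      L * (β * (U x * L)) * (n x * w n) ≤
      ((n + Pi.single x L : V → ℕ) x : ℝ) * w (n + Pi.single x L) := by
    intro n
    rw [hw, weight_add_single_nat hx, ← hw]
    simp only [Pi.add_apply, Pi.single_eq_same]
    have h1 : 1 - β * (U x * (L * n x + L * L / 2) + |μ x| * L) ≤
        Real.exp (-β * (U x * (L * n x + L * (L - 1) / 2) - μ x * L)) := by
      refine le_trans ?_ (Real.add_one_le_exp _)
      have h2 : U x * (L * n x + L * (L - 1) / 2) - μ x * L ≤
          U x * (L * n x + L * L / 2) + |μ x| * L := by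
        have h3 : (0 : ℝ) ≤ U x * L / 2 := by have := hU x; positivity
        have h4 : -μ x * L ≤ |μ x| * L :=
          mul_le_mul_of_nonneg_right (neg_le_abs _) (Nat.cast_nonneg _)
        nlinarith
      have := mul_le_mul_of_nonneg_left h2 hβ.le
      linarith
    have h5 : (L : ℝ) * Real.exp (-β * (U x * (L * n x + L * (L - 1) / 2) - μ x * L)) ≤
        ((n x + L : ℕ) : ℝ) * Real.exp (-β * (U x * (L * n x + L * (L - 1) / 2) - μ x * L)) :=
      mul_le_mul_of_nonneg_right (by exact_mod_cast Nat.le_add_left _ _) (Real.exp_nonneg _)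
    calc _ = L * (1 - β * (U x * (L * n x + L * L / 2) + |μ x| * L)) * w n := by ring
      _ ≤ ((n x + L : ℕ) : ℝ) *
          Real.exp (-β * (U x * (L * n x + L * (L - 1) / 2) - μ x * L)) * w n := by
        refine mul_le_mul_of_nonneg_right (le_trans ?_ h5) (hw0 n)
        exact mul_le_mul_of_nonneg_left h1 (Nat.cast_nonneg _)
      _ = _ := by ring
  have h1 := Summable.tsum_le_tsum hstep
    ((hsw.mul_left _).sub (hsn.mul_left _)) (hsn.comp_injective hinj)
  rw [(hsw.mul_left _).tsum_sub (hsn.mul_left _), tsum_mul_left, tsum_mul_left,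
    occupation_mul_partition hE hU hβ] at h1
  have h2 := tsum_comp_le_tsum_of_inj hsn (fun n => mul_nonneg (Nat.cast_nonneg _) (hw0 n)) hinj
  rw [occupation_mul_partition hE hU hβ] at h2
  refine le_of_mul_le_mul_right ?_ hZ
  refine le_trans (le_of_eq ?_) (h1.trans h2)
  rw [← partition]
  ring

/-! ### Removing the sites one by one -/

/-- The total hopping amplitude between two sites. -/
def coupling (E : Finset (Sym2 V)) (J : Sym2 V → ℝ) (x z : V) : ℝ :=
  ∑ e ∈ E with z ∈ e, if x ∈ e then |J e| else 0

/-- The hopping amplitudes without those of the edges at `x`. -/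
def isolate (x : V) (J : Sym2 V → ℝ) (e : Sym2 V) : ℝ := if x ∈ e then 0 else J e

theorem coupling_nonneg (x z : V) : 0 ≤ coupling E J x z :=
  Finset.sum_nonneg fun e _ => by split_ifs <;> positivity

/-- Makes μ_z plus strength an invariant of the induction for z ≠ x: isolating x raises μ_z by
exactly the strength lost at z. -/
theorem strength_isolate_add_coupling (x z : V) :
    strength E (isolate x J) z + coupling E J x z = strength E J z := by
  rw [strength, coupling, strength, ← Finset.sum_add_distrib]
  refine Finset.sum_congr rfl fun e _ => ?_
  by_cases h : x ∈ e <;> simp [isolate, h]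

theorem coupling_self (x : V) : coupling E J x x = strength E J x := by
  refine Finset.sum_congr rfl fun e he => ?_
  rw [if_pos (Finset.mem_filter.1 he).2]

/-- An edge at x has at most one end point different from x. -/
theorem sum_coupling_le (x : V) :
    ∑ z ∈ Finset.univ.erase x, coupling E J x z ≤ strength E J x := by
  simp only [coupling, strength, Finset.sum_filter]
  rw [Finset.sum_comm]
  refine Finset.sum_le_sum fun e _ => ?_
  by_cases hx : x ∈ e
  · simp only [hx, if_true]
    obtain ⟨y, rfl⟩ := Sym2.mem_iff_exists.1 hx
    have h : ∀ z ∈ Finset.univ.erase x, (if z ∈ s(x, y) then |J s(x, y)| else 0) ≤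
        if z = y then |J s(x, y)| else 0 := by
      intro z hz
      have hzx := Finset.ne_of_mem_erase hz
      simp only [Sym2.mem_iff, hzx, false_or, le_refl]
    refine (Finset.sum_le_sum h).trans ?_
    rw [Finset.sum_ite_eq']
    split_ifs
    · exact le_rfl
    · exact abs_nonneg _
  · simp [hx]

/-- The occupation of a site is bounded by occupations in the model without its edges, with
increased chemical potentials. -/
theorem mul_occupation_le (hE : ∀ e ∈ E, ¬ e.IsDiag) (hU : ∀ x, 0 < U x) {β : ℝ} (hβ : 0 < β)
    (x : V) (t : ℝ) : t * occupation (ham E J U μ) β x ≤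
      ∑ z, ((Pi.single x t : V → ℝ) z + coupling E J x z) * occupation (ham E (isolate x J) U
        (fun z => μ z + ((Pi.single x t : V → ℝ) z + coupling E J x z))) β z := by
  set τ : V → ℝ := Pi.single x t with hτ
  set ν : V → ℝ := fun z => μ z + (τ z + coupling E J x z) with hν
  have hZ := partition_pos (hamRes E J U μ) (summable_weight_ham (J := J) (μ := μ) hE hU hβ)
  have h1 := exp_occupation_mul_partition_le (J := J) (μ := μ) hE hU hβ τ
  -- Deleting the edges at x is paid for by raising μ_z by the coupling of z to x.
  have h2 : partition (ham E J U (fun z => μ z + τ z)) β ≤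
      partition (ham E (isolate x J) U ν) β := by
    refine tsum_le_tsum_of_sector (summable_weight_ham hE hU hβ) (summable_weight_ham hE hU hβ) ?_
    refine fun N => sum_weight_ham_le hE (fun z => le_of_eq ?_) hβ.le N
    have : ν z - (μ z + τ z) = coupling E J x z := by simp only [hν]; ring
    rw [this, coupling]
    refine Finset.sum_congr rfl fun e _ => ?_
    by_cases h : x ∈ e <;> simp [isolate, h]
  -- Lowering ν back to μ costs occupations of the isolated model; restoring the hopping at x
  -- afterwards is free.
  have h3 := exp_occupation_mul_partition_le (J := isolate x J) (μ := ν) hE hU hβ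
    (fun z => -(τ z + coupling E J x z))
  have hνμ : (fun z => ν z + -(τ z + coupling E J x z)) = μ := by
    funext z
    simp only [hν]
    ring
  rw [hνμ] at h3
  have h4 : partition (ham E (isolate x J) U μ) β ≤ partition (ham E J U μ) β :=
    partition_le_of_remove hE hU hβ x
  have h5 : ∑ z, τ z * occupation (ham E J U μ) β z = t * occupation (ham E J U μ) β x := by
    rw [Finset.sum_eq_single x (fun z _ hz => by simp [hτ, hz]) (by simp)]
    simp [hτ]
  rw [h5] at h1
  simp only [neg_mul, Finset.sum_neg_distrib, mul_neg] at h3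
  set A := ∑ z, (τ z + coupling E J x z) * occupation (ham E (isolate x J) U ν) β z
  have h6 : partition (ham E (isolate x J) U ν) β ≤
      Real.exp (β * A) * partition (ham E J U μ) β := by
    have := mul_le_mul_of_nonneg_left (h3.trans h4) (Real.exp_nonneg (β * A))
    rwa [← mul_assoc, ← Real.exp_add, add_neg_cancel, Real.exp_zero, one_mul] at this
  have h7 := le_of_mul_le_mul_right (h1.trans (h2.trans h6)) hZ
  exact le_of_mul_le_mul_left (Real.exp_le_exp.1 h7) hβ

/-- The occupations are of order `β^(-1/2)`, uniformly in the number of sites. All sites outside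
of `S` are isolated. -/
theorem occupation_le (hE : ∀ e ∈ E, ¬ e.IsDiag) {u : ℝ} (hu : 0 < u) (hU : ∀ x, u ≤ U x)
    {β R B : ℝ} (hβ : 0 < β) (hβ1 : Real.sqrt β ≤ 1) (hR : Real.sqrt β * R ≤ 1 / 2)
    (hB : Real.sqrt β * B ≤ 1) (S : Finset V) : ∀ (J : Sym2 V → ℝ) (μ : V → ℝ),
      (∀ z ∈ S, μ z + strength E J z ≤ B) → (∀ z ∈ S, strength E J z ≤ R) →
      (∀ e ∈ E, ∀ z ∈ e, z ∉ S → J e = 0) → ∀ x ∈ S,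
      occupation (ham E J U μ) β x ≤ 3 * (3 / u + 2) / Real.sqrt β := by
  have hU0 : ∀ x, 0 < U x := fun x => hu.trans_le (hU x)
  induction S using Finset.strongInduction with | _ S ih => ?_
  intro J μ hμ hJ hS x hxS
  set s := Real.sqrt β with hs
  have hs0 : 0 < s := Real.sqrt_pos.2 hβ
  set C := 3 / u + 2 with hC
  have hC0 : 0 < C := by positivity
  -- The choice t = 1/s dominates R, yet keeps the raised chemical potential at x below 2/s, as the
  -- one-site bound requires.
  have hmain := mul_occupation_le (J := J) (μ := μ) hE hU0 hβ x (1 / s)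
  set τ : V → ℝ := Pi.single x (1 / s) with hτ
  set ν : V → ℝ := fun z => μ z + (τ z + coupling E J x z) with hν
  set o := occupation (ham E (isolate x J) U ν) β with ho
  have hτ0 : ∀ z, z ≠ x → τ z = 0 := fun z hz => by simp [hτ, hz]
  have hτx : τ x = 1 / s := by simp [hτ]
  have hox : o x ≤ C / s := by
    refine occupation_le_of_isolated hE hu hU hβ hβ1 (fun e _ hxe => by simp [isolate, hxe]) ?_
    have h1 : ν x = μ x + strength E J x + 1 / s := by
      simp only [hν, hτx, coupling_self]
      ring
    have h2 : B ≤ 1 / s := by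
      rw [le_div_iff₀ hs0]
      linarith
    have h3 := hμ x hxS
    rw [h1, ← hs]
    have : 2 / s = 1 / s + 1 / s := by ring
    linarith
  have ho' : ∀ z ∈ Finset.univ.erase x,
      (τ z + coupling E J x z) * o z ≤ coupling E J x z * (3 * C / s) := by
    intro z hz
    have hzx := Finset.ne_of_mem_erase hz
    rw [hτ0 z hzx, zero_add]
    by_cases hzS : z ∈ S
    · refine mul_le_mul_of_nonneg_left ?_ (coupling_nonneg x z)
      refine ih (S.erase x) (Finset.erase_ssubset hxS) (isolate x J) ν ?_ ?_ ?_ z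
        (Finset.mem_erase.2 ⟨hzx, hzS⟩)
      · intro y hy
        obtain ⟨hyx, hyS⟩ := Finset.mem_erase.1 hy
        have h1 := hμ y hyS
        have h2 := strength_isolate_add_coupling (E := E) (J := J) x y
        simp only [hν, hτ0 y hyx]
        linarith
      · intro y hy
        have h1 := hJ y (Finset.mem_of_mem_erase hy)
        have h2 := strength_isolate_add_coupling (E := E) (J := J) x y
        have h3 := coupling_nonneg (E := E) (J := J) x y
        linarith
      · intro e he y hye hy
        by_cases hxe : x ∈ e
        · simp [isolate, hxe]
        · have hyx : y ≠ x := by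
            rintro rfl
            exact hxe hye
          have hyS : y ∉ S := fun h => hy (Finset.mem_erase.2 ⟨hyx, h⟩)
          simp [isolate, hxe, hS e he y hye hyS]
    · have h0 : coupling E J x z = 0 := by
        refine Finset.sum_eq_zero fun e he => ?_
        obtain ⟨heE, hze⟩ := Finset.mem_filter.1 he
        simp [hS e heE z hze hzS]
      simp [h0]
  rw [← Finset.add_sum_erase _ _ (Finset.mem_univ x), hτx, coupling_self] at hmain
  have h1 := Finset.sum_le_sum ho'
  rw [← Finset.sum_mul] at h1
  have h2 := sum_coupling_le (E := E) (J := J) x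
  have h3 := hJ x hxS
  have hpos : 0 < 3 * C / s := by positivity
  have h4 : (∑ z ∈ Finset.univ.erase x, coupling E J x z) * (3 * C / s) ≤ R * (3 * C / s) :=
    mul_le_mul_of_nonneg_right (h2.trans h3) hpos.le
  have ho0 : 0 ≤ o x := occupation_nonneg β x
  have h5 : (1 / s + strength E J x) * o x ≤ (1 / s + R) * (C / s) := by
    have hsx : 0 ≤ strength E J x := Finset.sum_nonneg fun _ _ => abs_nonneg _
    exact mul_le_mul (by linarith) hox ho0 (by have : 0 < 1 / s := by positivity
                                               linarith)
  have h6 : 1 / s * occupation (ham E J U μ) β x ≤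
      (1 / s + R) * (C / s) + R * (3 * C / s) := by linarith
  have h7 := mul_le_mul_of_nonneg_left h6 hs0.le
  have e1 : s * (1 / s * occupation (ham E J U μ) β x) = occupation (ham E J U μ) β x := by
    field_simp
  -- With sR ≤ 1/2 the prefactor is at most 3, so the induction reproduces its own constant 3C.
  have e2 : s * ((1 / s + R) * (C / s) + R * (3 * C / s)) = (1 + 4 * (s * R)) * (C / s) := by
    field_simp
    ring
  rw [e1, e2] at h7
  refine h7.trans ?_
  rw [mul_div_assoc]
  exact mul_le_mul_of_nonneg_right (by linarith) (by positivity)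

/-! ### The thermal average of the model -/

theorem hasThermalAverage_ham (hE : ∀ e ∈ E, ¬ e.IsDiag) (hU : ∀ x, 0 < U x) {β : ℝ}
    (hβ : 0 < β) (x : V) : HasThermalAverage (ham E J U μ) β (number x) ∧
      thermalAverage (ham E J U μ) β (number x) = (occupation (ham E J U μ) β x : ℂ) := by
  have hB := isBoltzmann_boltzmann (exists_isBoltzmann_ham (J := J) (μ := μ) hE hU hβ)
  have hR := hamRes E J U μ
  have hs := summable_weight_ham (J := J) (μ := μ) hE hU hβ
  have hn := summable_number_mul_weight_ham (J := J) (μ := μ) hE hU hβ x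
  have h1 : gibbsDiag (ham E J U μ) β 1 = fun n => ((weight (ham E J U μ) β n : ℝ) : ℂ) := by
    funext n
    rw [gibbsDiag_of_diag hR hB (d := fun _ => 1) (by simp), one_mul]
  have h2 : gibbsDiag (ham E J U μ) β (number x) =
      fun n => ((n x * weight (ham E J U μ) β n : ℝ) : ℂ) := by
    funext n
    rw [gibbsDiag_of_diag hR hB (d := fun n => (n x : ℝ)) (by simpa using number_ket x)]
  have t1 : gibbsTrace (ham E J U μ) β 1 = (partition (ham E J U μ) β : ℂ) := by
    rw [gibbsTrace, h1, ← Complex.ofReal_tsum, partition]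
  have t2 : gibbsTrace (ham E J U μ) β (number x) =
      ((∑' n, n x * weight (ham E J U μ) β n : ℝ) : ℂ) := by
    rw [gibbsTrace, h2, ← Complex.ofReal_tsum]
  refine ⟨⟨hB, ?_, ?_, ?_⟩, ?_⟩
  · rw [h1]
    exact Complex.summable_ofReal.2 hs
  · rw [h2]
    exact Complex.summable_ofReal.2 hn
  · rw [t1]
    exact_mod_cast (partition_pos hR hs).ne'
  · rw [thermalAverage, t1, t2, occupation, average, Complex.ofReal_div]

open scoped Classical in
theorem Model.strength_le {M : Model V} {J μ Umin Umax : ℝ} {D : ℕ}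
    (h : M.BoundedBy J μ Umin Umax D) (x : V) : strength M.graph.edgeFinset M.J x ≤ |J| * D := by
  have hcard : (M.graph.edgeFinset.filter fun e => x ∈ e).card ≤ D := by
    refine le_trans ?_ (h.degree_le x)
    rw [Set.ncard_eq_toFinset_card']
    refine le_trans (Finset.card_le_card ?_)
      (Finset.card_image_le (s := (M.graph.neighborSet x).toFinset) (f := fun y => s(x, y)))
    intro e he
    obtain ⟨he, hx⟩ := Finset.mem_filter.1 he
    obtain ⟨y, rfl⟩ := Sym2.mem_iff_exists.1 hx
    rw [Finset.mem_image]
    exact ⟨y, by simpa using he, rfl⟩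
  calc strength M.graph.edgeFinset M.J x
      ≤ ∑ e ∈ M.graph.edgeFinset with x ∈ e, |J| := by
        refine Finset.sum_le_sum fun e he => ?_
        refine (h.abs_J_le e ?_).trans (le_abs_self J)
        exact SimpleGraph.mem_edgeFinset.1 (Finset.mem_filter.1 he).1
    _ = (M.graph.edgeFinset.filter fun e => x ∈ e).card * |J| := by
        rw [Finset.sum_const, nsmul_eq_mul]
    _ ≤ D * |J| := mul_le_mul_of_nonneg_right (by exact_mod_cast hcard) (abs_nonneg J)
    _ = |J| * D := mul_comm _ _

/-- The lower bound on the occupation of a site without hopping, from the upper bound. -/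
theorem div_sqrt_le_occupation (hE : ∀ e ∈ E, ¬ e.IsDiag) (hU : ∀ x, 0 < U x) {β : ℝ}
    (hβ : 0 < β) {x : V} (hx : ∀ e ∈ E, x ∈ e → J e = 0) {a C W m : ℝ} (ha : 0 < a) (ha1 : a ≤ 1)
    (haC : a * (W * C + W + m) ≤ 1 / 2) (hW : U x ≤ W) (hm : |μ x| ≤ m)
    (hC : occupation (ham E J U μ) β x ≤ C / Real.sqrt β) (hβa : Real.sqrt β ≤ a) :
    a / 4 / Real.sqrt β ≤ occupation (ham E J U μ) β x := by
  set s := Real.sqrt β with hs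
  have hs0 : 0 < s := Real.sqrt_pos.2 hβ
  have hss : s * s = β := Real.mul_self_sqrt hβ.le
  -- For L = ⌊a/s⌋ the correction in brackets is at most a(WC + W + m) ≤ 1/2, leaving L/2. As a/s ≥
  -- 1, also L ≥ a/(2s), whence the factor a/4.
  have h := le_occupation_of_isolated (μ := μ) hE hU hβ hx ⌊a / s⌋₊
  set o := occupation (ham E J U μ) β x
  have ho0 : 0 ≤ o := occupation_nonneg β x
  set L := ⌊a / s⌋₊
  have h1 : 1 ≤ a / s := by rwa [le_div_iff₀ hs0, one_mul]
  have hL1 : (L : ℝ) ≤ a / s := Nat.floor_le (by positivity)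
  have hL2 : a / s < L + 1 := Nat.lt_floor_add_one _
  have hL3 : (1 : ℝ) ≤ L := by exact_mod_cast Nat.le_floor (by simpa using h1)
  have hL4 : s * L ≤ a := by
    have := mul_le_mul_of_nonneg_left hL1 hs0.le
    rwa [mul_div_cancel₀ _ hs0.ne'] at this
  have ho1 : s * o ≤ C := by
    have := mul_le_mul_of_nonneg_left hC hs0.le
    rwa [mul_div_cancel₀ _ hs0.ne'] at this
  have hsL : 0 ≤ s * L := by positivity
  have hso : 0 ≤ s * o := by positivity
  have hW0 : 0 ≤ W := (hU x).le.trans hW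
  have hm0 : 0 ≤ m := (abs_nonneg _).trans hm
  have k1 : (s * L) * (s * o) ≤ a * C := mul_le_mul hL4 ho1 hso ha.le
  have k2 : (s * L) * (s * L) / 2 ≤ a := by nlinarith
  have k3 : U x * ((s * L) * (s * o) + (s * L) * (s * L) / 2) ≤ W * (a * C + a) :=
    mul_le_mul hW (by linarith) (by positivity) hW0
  have k4 : |μ x| * (s * (s * L)) ≤ m * a := by
    refine mul_le_mul hm ?_ (by positivity) hm0
    nlinarith
  have k5 : β * (U x * (L * o + L * L / 2) + |μ x| * L) ≤ 1 / 2 := by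
    calc β * (U x * (L * o + L * L / 2) + |μ x| * L)
        = U x * ((s * L) * (s * o) + (s * L) * (s * L) / 2) + |μ x| * (s * (s * L)) := by
          rw [← hss]; ring
      _ ≤ W * (a * C + a) + m * a := add_le_add k3 k4
      _ = a * (W * C + W + m) := by ring
      _ ≤ 1 / 2 := haC
  have k6 : (L : ℝ) * (1 / 2) ≤ o :=
    le_trans (mul_le_mul_of_nonneg_left (by linarith) (by positivity)) h
  have : a / 4 / s = a / s / 4 := by ring
  rw [this]
  linarith

end Model

end BoseHubbard

end

/-! ### Choice of the constants and conclusion -/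

theorem lemma1 (Umin Umax μ : ℝ) (hUmin : 0 < Umin) :
    ∃ C c : ℝ, 0 < C ∧ 0 < c ∧
      ∀ (J : ℝ) (D : ℕ), ∃ βstar : ℝ, 0 < βstar ∧
        ∀ (V : Type*) [Fintype V] [DecidableEq V] (M : BoseHubbard.Model V),
          M.BoundedBy J μ Umin Umax D →
          ∀ β : ℝ, 0 < β → β < βstar → ∀ x : V,
            BoseHubbard.HasThermalAverage M.hamiltonian β (BoseHubbard.number x) ∧
            ∃ r : ℝ,
              BoseHubbard.thermalAverage M.hamiltonian β (BoseHubbard.number x) = (r : ℂ) ∧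
              r ≤ C / Real.sqrt β ∧
              ((∀ e ∈ M.graph.edgeSet, M.J e = 0) → c / Real.sqrt β ≤ r) := by
  classical
  set C : ℝ := 3 * (3 / Umin + 2) with hC
  have hC0 : 0 < C := by positivity
  set Q : ℝ := |Umax| * C + |Umax| + |μ| with hQ
  have hQ0 : 0 ≤ Q := by positivity
  -- Chosen so that a ≤ 1 and aQ ≤ 1/2; it depends only on Umin, Umax and μ, as the lower constant
  -- a/4 must.
  set a : ℝ := 1 / (2 * Q + 2) with ha
  have ha0 : 0 < a := by positivity
  have ha1 : a ≤ 1 := by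
    rw [ha, div_le_one (by positivity)]
    linarith
  have haQ : a * Q ≤ 1 / 2 := by
    rw [ha, div_mul_eq_mul_div, div_le_div_iff₀ (by positivity) (by norm_num)]
    linarith
  refine ⟨C, a / 4, hC0, by positivity, fun J D => ?_⟩
  set R : ℝ := |J| * D with hR
  have hR0 : 0 ≤ R := by positivity
  set B : ℝ := |μ| + R with hB
  have hB0 : 0 ≤ B := by positivity
  have hRB : R ≤ B := by
    have := abs_nonneg μ
    linarith
  -- The bound on √β: it ensures √β ≤ a for the lower bound and √β·B ≤ 1/2 for the induction. Only
  -- here do J and D enter.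
  set σ : ℝ := a / (1 + 2 * B) with hσ
  have hσ0 : 0 < σ := by positivity
  have hσa : σ ≤ a := div_le_self ha0.le (by linarith)
  have hσB : σ * (2 * B) ≤ 1 := by
    rw [hσ, div_mul_eq_mul_div, div_le_one (by positivity)]
    nlinarith
  refine ⟨σ ^ 2, by positivity, ?_⟩
  intro V _ _ M hM β hβ hβσ x
  have hsσ : Real.sqrt β ≤ σ := (Real.sqrt_le_left hσ0.le).2 hβσ.le
  have hs0 : 0 ≤ Real.sqrt β := Real.sqrt_nonneg β
  have hsB : Real.sqrt β * B ≤ 1 / 2 := by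
    have := mul_le_mul_of_nonneg_right hsσ hB0
    linarith
  have hsR : Real.sqrt β * R ≤ 1 / 2 := (mul_le_mul_of_nonneg_left hRB hs0).trans hsB
  have hE : ∀ e ∈ M.graph.edgeFinset, ¬ e.IsDiag := fun e he =>
    M.graph.not_isDiag_of_mem_edgeFinset he
  have hU : ∀ x, 0 < M.U x := fun x => hUmin.trans_le (hM.Umin_le x)
  have hH : M.hamiltonian = BoseHubbard.ham M.graph.edgeFinset M.J M.U M.μ := rfl
  have hup : BoseHubbard.occupation (BoseHubbard.ham M.graph.edgeFinset M.J M.U M.μ) β x ≤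
      C / Real.sqrt β := by
    refine BoseHubbard.occupation_le hE hUmin hM.Umin_le hβ (hsσ.trans (hσa.trans ha1)) hsR
      (hsB.trans (by norm_num)) Finset.univ M.J M.μ ?_ ?_ ?_ x (Finset.mem_univ x)
    · intro z _
      have h1 := BoseHubbard.Model.strength_le hM z
      have h2 := (le_abs_self _).trans ((hM.abs_μ_le z).trans (le_abs_self μ))
      exact add_le_add h2 h1
    · exact fun z _ => BoseHubbard.Model.strength_le hM z
    · exact fun e _ z _ hz => absurd (Finset.mem_univ z) hz
  obtain ⟨h1, h2⟩ := BoseHubbard.hasThermalAverage_ham (J := M.J) (μ := M.μ) hE hU hβ x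
  rw [hH]
  refine ⟨h1, _, h2, hup, fun hJ => ?_⟩
  exact BoseHubbard.div_sqrt_le_occupation hE hU hβ
    (fun e he _ => hJ e (SimpleGraph.mem_edgeFinset.1 he)) ha0 ha1 haQ
    ((hM.le_Umax x).trans (le_abs_self Umax)) ((hM.abs_μ_le x).trans (le_abs_self μ)) hup
    (hsσ.trans hσa)
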